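/- Let $K$ be a number field with ring of integers $\mathcal O_K$ and class number $h_K$, let $G$ be a finite group, let $\chi:G\to K^*$ be a nontrivial character with values in $K$, and let $g_0\in G$ be such that $\chi_0=\chi(g_0)$ generates $\chi(G)$ (for instance $G=\langle g_0\rangle$ cyclic and $K\supseteq\mathbb Q(\chi_0)$). Let $\rho_\chi:G\to \mathrm{GL}_2(K)$, $\rho_\chi(g)=\begin{pmatrix}1&0\\0&\chi(g)\end{pmatrix}$. For a finite place $P$ of $K$ with completion $K_P$, additive valuation $\nu_P$, integer ring $\mathcal O_P$ and uniformizer $\pi$, let $\mathfrak t_P$ be the Bruhat–Tits tree: its vertices are the balls $B=B_a^{[n]}=\{z\in K_P: \nu_P(z-a)\ge n\}$ ($a\in K_P$, $n\in\mathbb Z$), two balls being neighbours when one is a maximal proper sub-ball of the other. The maximal order of the vertex $B_a^{[n]}$ is $\mathrm{End}_{\mathcal O_P}(\Lambda)\subseteq\mathbb M_2(K_P)$, where $\Lambda$ is the $\mathcal O_P$-lattice generated by $\binom a1$ and $\binom{\pi^n}0$. The standard apartment consists of the balls containing $0$; the anchor of a vertex is the vertex of the standard apartment closest to it for the graph distance.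 For a vertex $w$ of the standard apartment, the side branch of $\mathtt r=\begin{pmatrix}1&0\\0&\chi_0\end{pmatrix}$ at $w$ is the set of vertices with anchor $w$ whose maximal order contains $\mathtt r$. A unit $u\in\mathcal O_K^*$ acts on the vertices through the matrix $\begin{pmatrix}1&0\\0&u\end{pmatrix}$, that is, through the Moebius transformation $z\mapsto z/u$; it fixes the standard apartment pointwise and preserves every side branch. Let $P_1,\dots,P_r$ be the primes of $\mathcal O_K$ dividing $1-\chi_0$, choose a vertex $w_i$ of the standard apartment of $\mathfrak t_{P_i}$ for every $i$, and let $\mathbb B$ be the product of the side branches of $\mathtt r$ at the $w_i$ (a single point if $r=0$), with the coordinatewise action of $\mathcal O_K^*$. Then the number $\mathbf O$ of $\mathcal O_K^*$-orbits in $\mathbb B$ is finite, and the number of $\mathrm{GL}_2(\mathcal O_K)$-conjugacy classes of representations $\varphi:G\to\mathrm{GL}_2(\mathcal O_K)$ that are conjugate to $\rho_\chi$ by a matrix in $\mathrm{GL}_2(K)$ is finite and equal to $\mathbf O\,h_K$. -/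

import Mathlib

open scoped NumberField WithZero
open IsDedekindDomain

noncomputable section

/-! ### Integral representations -/

namespace IntegralRep

variable {K : Type*} [Field K] {G : Type*} [Group G]

/-- The matrix `diag(1, a)` with `a` a unit of a commutative ring. -/
def diagOne {R : Type*} [CommRing R] : Rˣ →* GL (Fin 2) R where
  toFun a := ⟨!![1, 0; 0, (a : R)], !![1, 0; 0, ((a⁻¹ : Rˣ) : R)],
    by simp [Matrix.one_fin_two], by simp [Matrix.one_fin_two]⟩
  map_one' := by ext i j; fin_cases i <;> fin_cases j <;> simp
  map_mul' a b := by ext i j; fin_cases i <;> fin_cases j <;> simp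

/-- The decomposable representation `ρ_χ = 1 ⊕ χ`, that is `g ↦ diag(1, χ(g))`. -/
def rho (χ : G →* Kˣ) : G →* GL (Fin 2) K := diagOne.comp χ

/-- The `𝓞_K`-representations `φ : G → GL₂(𝓞_K)` that become conjugate to `ρ_χ` by a matrix
of `GL₂(K)`. -/
def KConj (χ : G →* Kˣ) : Type _ :=
  {φ : G →* GL (Fin 2) (𝓞 K) // ∃ T : GL (Fin 2) K, ∀ g : G,
    T * Matrix.GeneralLinearGroup.map (algebraMap (𝓞 K) K) (φ g) * T⁻¹ = rho χ g}

/-- Conjugacy of integral representations by a matrix of `GL₂(𝓞_K)`. -/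
instance conjSetoid (χ : G →* Kˣ) : Setoid (KConj χ) where
  r φ ψ := ∃ T : GL (Fin 2) (𝓞 K), ∀ g : G, T * φ.1 g * T⁻¹ = ψ.1 g
  iseqv :=
    { refl := fun _ => ⟨1, fun g => by simp⟩
      symm := fun ⟨T, hT⟩ => ⟨T⁻¹, fun g => by rw [← hT g]; group⟩
      trans := fun ⟨T, hT⟩ ⟨S, hS⟩ => ⟨S * T, fun g => by rw [← hS g, ← hT g]; group⟩ }

/-- The set of `GL₂(𝓞_K)`-conjugacy classes of `𝓞_K`-representations of `G` in the
`K`-conjugacy class of `ρ_χ`. -/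
def Classes (χ : G →* Kˣ) : Type _ := Quotient (conjSetoid χ)

/-- For a finite group `G`, the value `χ(g)` is a root of unity, hence an element of `𝓞_K`. -/
def charValue [Finite G] (χ : G →* Kˣ) (g : G) : 𝓞 K :=
  ⟨(χ g : K), by
    refine IsIntegral.of_pow (n := Nat.card G) Nat.card_pos ?_
    rw [← Units.val_pow_eq_pow_val, ← map_pow, pow_card_eq_one']
    simpa using isIntegral_one⟩

end IntegralRep

/-! ### The Bruhat-Tits tree at a finite place -/

namespace BruhatTits

variable {K : Type*} [Field K] [NumberField K]

/-- A vertex of the Bruhat-Tits tree at `v`: a ball `{z | v(z - a) ≥ n}` of the completion `K_v`.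
In Mathlib's multiplicative notation an element has additive valuation at least `n` when its
valuation is at most `exp (-n)`. -/
@[ext]
structure Vertex (v : HeightOneSpectrum (𝓞 K)) where
  ball : Set (v.adicCompletion K)
  isBall : ∃ (a : v.adicCompletion K) (n : ℤ),
    ball = {z | Valued.v (z - a) ≤ (WithZero.exp (-n) : ℤᵐ⁰)}

variable {v : HeightOneSpectrum (𝓞 K)}

/-- Vertices are ordered by inclusion of balls. -/
instance : PartialOrder (Vertex v) :=
  PartialOrder.lift Vertex.ball (fun _ _ h => Vertex.ext h)

/-- The Bruhat-Tits tree: two vertices are neighbours when one of the balls is a maximal proper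
sub-ball of the other one. -/
def tree (v : HeightOneSpectrum (𝓞 K)) : SimpleGraph (Vertex v) := SimpleGraph.hasse (Vertex v)

/-- The lattice in `K_v²` attached to a vertex; for the ball `B` of centre `a` and exponent `n`
it is the `𝓞_v`-lattice generated by `(a, 1)` and `(π ^ n, 0)`. -/
def Vertex.lattice (x : Vertex v) :
    Submodule (v.adicCompletionIntegers K) (Fin 2 → v.adicCompletion K) :=
  Submodule.span _ {w | ∃ b ∈ x.ball, w = ![b, 1]}

/-- The maximal order of `M₂(K_v)` attached to a vertex: the endomorphism ring of its lattice. -/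
def Vertex.maximalOrder (x : Vertex v) : Subring (Matrix (Fin 2) (Fin 2) (v.adicCompletion K)) where
  carrier := {M | ∀ w ∈ x.lattice, M.mulVec w ∈ x.lattice}
  mul_mem' {M N} hM hN w hw := by
    rw [← Matrix.mulVec_mulVec]; exact hM _ (hN w hw)
  one_mem' w hw := by simpa using hw
  add_mem' {M N} hM hN w hw := by
    rw [Matrix.add_mulVec]; exact add_mem (hM w hw) (hN w hw)
  zero_mem' w hw := by simp
  neg_mem' {M} hM w hw := by
    rw [Matrix.neg_mulVec]; exact neg_mem (hM w hw)

/-- The matrix `diag(1, c)` over the completion `K_v`. -/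
def diagMat (v : HeightOneSpectrum (𝓞 K)) (c : 𝓞 K) :
    Matrix (Fin 2) (Fin 2) (v.adicCompletion K) :=
  !![1, 0; 0, algebraMap (𝓞 K) (v.adicCompletion K) c]

/-- The standard apartment: the path from `0` to `∞`, formed by the balls containing `0`. -/
def apartment (v : HeightOneSpectrum (𝓞 K)) : Set (Vertex v) := {x | 0 ∈ x.ball}

/-- `w` is the anchor of `x`: the vertex of the standard apartment that is closest to `x`. -/
def IsAnchor (x w : Vertex v) : Prop :=
  w ∈ apartment v ∧ ∀ w' ∈ apartment v, (tree v).dist x w ≤ (tree v).dist x w'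

/-- The side branch of `diag(1, c)` at the anchor `w`: the vertices with anchor `w` whose maximal
order contains `diag(1, c)`. -/
def SideBranch (v : HeightOneSpectrum (𝓞 K)) (c : 𝓞 K) (w : Vertex v) : Set (Vertex v) :=
  {x | diagMat v c ∈ x.maximalOrder ∧ IsAnchor x w}

/-! ### The action of global units through `u ↦ diag(1, u)` -/

lemma unit_ne_zero (v : HeightOneSpectrum (𝓞 K)) (u : (𝓞 K)ˣ) :
    algebraMap (𝓞 K) (v.adicCompletion K) u ≠ 0 :=
  (u.isUnit.map (algebraMap (𝓞 K) (v.adicCompletion K))).ne_zero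

lemma valued_unit (v : HeightOneSpectrum (𝓞 K)) (u : (𝓞 K)ˣ) :
    Valued.v (algebraMap (𝓞 K) (v.adicCompletion K) u) = (1 : ℤᵐ⁰) := by
  have h : ∀ u : (𝓞 K)ˣ, Valued.v (algebraMap (𝓞 K) (v.adicCompletion K) u) ≤ (1 : ℤᵐ⁰) :=
    fun u => v.coe_mem_adicCompletionIntegers (K := K) (u : 𝓞 K)
  refine le_antisymm (h u) ?_
  have h1 := h u⁻¹
  have h2 : algebraMap (𝓞 K) (v.adicCompletion K) (u : 𝓞 K) *
      algebraMap (𝓞 K) (v.adicCompletion K) ((u⁻¹ : (𝓞 K)ˣ) : 𝓞 K) = 1 := by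
    rw [← map_mul]; simp
  calc (1 : ℤᵐ⁰) = _ := by rw [← map_one (Valued.v (R := v.adicCompletion K)), ← h2, map_mul]
    _ ≤ _ := mul_le_of_le_one_right' h1

/-- The matrix `diag(1, u)` acts on vertices through its Moebius transformation `z ↦ z / u`. -/
instance : MulAction (𝓞 K)ˣ (Vertex v) where
  smul u x := ⟨(fun z => z / algebraMap (𝓞 K) (v.adicCompletion K) u) '' x.ball, by
    obtain ⟨a, n, h⟩ := x.isBall
    have hu := unit_ne_zero v u
    refine ⟨a / algebraMap (𝓞 K) (v.adicCompletion K) u, n, ?_⟩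
    ext z
    simp only [h, Set.mem_image, Set.mem_ofPred_eq]
    constructor
    · rintro ⟨y, hy, rfl⟩
      rwa [← sub_div, map_div₀, valued_unit, div_one]
    · intro hz
      refine ⟨z * algebraMap (𝓞 K) (v.adicCompletion K) u, ?_, by field_simp⟩
      have : z * algebraMap (𝓞 K) (v.adicCompletion K) u - a =
          (z - a / algebraMap (𝓞 K) (v.adicCompletion K) u) *
            algebraMap (𝓞 K) (v.adicCompletion K) u := by field_simp
      rwa [this, map_mul, valued_unit, mul_one]⟩
  one_smul x := by
    apply Vertex.ext
    change (fun z => z / algebraMap (𝓞 K) (v.adicCompletion K) (1 : (𝓞 K)ˣ)) '' x.ball = _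
    simp
  mul_smul u u' x := by
    apply Vertex.ext
    change (fun z => z / algebraMap (𝓞 K) (v.adicCompletion K) (u * u' : (𝓞 K)ˣ)) '' x.ball =
      (fun z => z / algebraMap (𝓞 K) (v.adicCompletion K) u) ''
        ((fun z => z / algebraMap (𝓞 K) (v.adicCompletion K) u') '' x.ball)
    rw [Set.image_image]
    congr 1
    funext z
    simp only [Units.val_mul, map_mul]
    rw [div_div, mul_comm]

lemma smul_ball (u : (𝓞 K)ˣ) (x : Vertex v) :
    (u • x).ball = (fun z => z / algebraMap (𝓞 K) (v.adicCompletion K) u) '' x.ball := rfl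

lemma smul_le_smul_iff (u : (𝓞 K)ˣ) (x y : Vertex v) : u • x ≤ u • y ↔ x ≤ y := by
  change (u • x).ball ⊆ (u • y).ball ↔ x.ball ⊆ y.ball
  rw [smul_ball, smul_ball]
  exact Set.image_subset_image_iff (fun a b h => (div_left_inj' (unit_ne_zero v u)).1 h)

lemma smul_adj (u : (𝓞 K)ˣ) {x y : Vertex v} (h : (tree v).Adj x y) :
    (tree v).Adj (u • x) (u • y) := by
  let e : Vertex v ≃o Vertex v := ⟨MulAction.toPerm u, smul_le_smul_iff u _ _⟩
  have key : ∀ {a b : Vertex v}, a ⋖ b → u • a ⋖ u • b := fun h => (apply_covBy_apply_iff e).2 h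
  exact h.imp key key

lemma dist_smul (u : (𝓞 K)ˣ) (x y : Vertex v) :
    (tree v).dist (u • x) (u • y) = (tree v).dist x y := by
  have key : ∀ (u : (𝓞 K)ˣ) (x y : Vertex v),
      Set.range (fun p : (tree v).Walk x y => p.length) ⊆
        Set.range (fun p : (tree v).Walk (u • x) (u • y) => p.length) := by
    rintro u x y _ ⟨p, rfl⟩
    exact ⟨p.map (⟨fun z => u • z, smul_adj u⟩ : tree v →g tree v), by simp⟩
  rw [SimpleGraph.dist_eq_sInf, SimpleGraph.dist_eq_sInf]
  congr 1
  refine Set.Subset.antisymm ?_ (key u x y)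
  have := key u⁻¹ (u • x) (u • y)
  rwa [inv_smul_smul, inv_smul_smul] at this

lemma smul_of_mem_apartment (u : (𝓞 K)ˣ) {w : Vertex v} (hw : w ∈ apartment v) : u • w = w := by
  obtain ⟨a, n, h⟩ := w.isBall
  have key : ∀ z, z ∈ w.ball ↔ Valued.v z ≤ (WithZero.exp (-n) : ℤᵐ⁰) := by
    have h0 : (0 : v.adicCompletion K) ∈ w.ball := hw
    rw [h, Set.mem_ofPred_eq, zero_sub, Valuation.map_neg] at h0
    intro z
    rw [h, Set.mem_ofPred_eq]
    constructor
    · intro hz; simpa using Valuation.map_add_le Valued.v hz h0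
    · intro hz; exact Valuation.map_sub_le Valued.v hz h0
  have hu := unit_ne_zero v u
  apply Vertex.ext
  ext z
  rw [smul_ball, Set.mem_image]
  constructor
  · rintro ⟨y, hy, rfl⟩
    rw [key, map_div₀, valued_unit, div_one]; exact (key y).1 hy
  · intro hz
    refine ⟨z * algebraMap (𝓞 K) (v.adicCompletion K) u, ?_, by field_simp⟩
    rw [key, map_mul, valued_unit, mul_one]; exact (key z).1 hz

/-- The action on vertices is compatible with the linear action of `diag(1, u)` on lattices. -/
lemma mulVec_mem_lattice (u : (𝓞 K)ˣ) (x : Vertex v) {w : Fin 2 → v.adicCompletion K}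
    (hw : w ∈ x.lattice) : (diagMat v u).mulVec w ∈ (u • x).lattice := by
  have hu := unit_ne_zero v u
  induction hw using Submodule.span_induction with
  | mem w hw =>
    obtain ⟨b, hb, rfl⟩ := hw
    have : (diagMat v (u : 𝓞 K)).mulVec ![b, 1] =
        (algebraMap (𝓞 K) (v.adicCompletionIntegers K) (u : 𝓞 K)) •
          ![b / algebraMap (𝓞 K) (v.adicCompletion K) u, 1] := by
      have h0 : algebraMap (𝓞 K) (v.adicCompletion K) (u : 𝓞 K) *
          (b / algebraMap (𝓞 K) (v.adicCompletion K) (u : 𝓞 K)) = b := by field_simp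
      funext i
      fin_cases i
      · change _ = algebraMap (𝓞 K) (v.adicCompletion K) (u : 𝓞 K) *
          (b / algebraMap (𝓞 K) (v.adicCompletion K) (u : 𝓞 K))
        rw [h0]
        simp [diagMat]
      · change _ = algebraMap (𝓞 K) (v.adicCompletion K) (u : 𝓞 K) * 1
        simp [diagMat]
    rw [this]
    exact Submodule.smul_mem _ _ (Submodule.subset_span ⟨_, ⟨b, hb, rfl⟩, rfl⟩)
  | zero => simp
  | add w w' _ _ h h' => rw [Matrix.mulVec_add]; exact add_mem h h'
  | smul r w _ h =>
    have : (diagMat v (u : 𝓞 K)).mulVec (r • w) = r • (diagMat v (u : 𝓞 K)).mulVec w :=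
      Matrix.mulVec_smul _ r w
    rw [this]
    exact Submodule.smul_mem _ _ h

lemma diagMat_mul (a b : 𝓞 K) : diagMat v a * diagMat v b = diagMat v (a * b) := by
  simp only [diagMat, Matrix.mul_fin_two, map_mul]
  simp

lemma smul_mem_sideBranch (u : (𝓞 K)ˣ) {c : 𝓞 K} {w x : Vertex v}
    (hx : x ∈ SideBranch v c w) : u • x ∈ SideBranch v c w := by
  refine ⟨fun y hy => ?_, hx.2.1, fun w' hw' => ?_⟩
  · have h1 := mulVec_mem_lattice u⁻¹ (u • x) hy
    rw [inv_smul_smul] at h1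
    have h2 := mulVec_mem_lattice u x (hx.1 _ h1)
    rw [Matrix.mulVec_mulVec, Matrix.mulVec_mulVec, diagMat_mul, diagMat_mul] at h2
    rwa [show (u : 𝓞 K) * c * ((u⁻¹ : (𝓞 K)ˣ) : 𝓞 K) = c by
      rw [mul_comm (u : 𝓞 K) c, mul_assoc, Units.mul_inv, mul_one]] at h2
  · have h1 := hx.2.2 w' hw'
    rw [← dist_smul u x w, ← dist_smul u x w', smul_of_mem_apartment u hx.2.1,
      smul_of_mem_apartment u hw'] at h1
    exact h1

/-- The action of the units on a side branch. -/
instance (c : 𝓞 K) (w : Vertex v) : MulAction (𝓞 K)ˣ (SideBranch v c w) where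
  smul u x := ⟨u • x.1, smul_mem_sideBranch u x.2⟩
  one_smul x := Subtype.ext (one_smul _ x.1)
  mul_smul u u' x := Subtype.ext (mul_smul u u' x.1)

/-- The finite places dividing `1 - c`. -/
abbrev BadPrimes (c : 𝓞 K) : Type _ :=
  {P : HeightOneSpectrum (𝓞 K) // P.asIdeal ∣ Ideal.span {1 - c}}

/-- The product `𝔹` of the side branches of `diag(1, c)` at the primes dividing `1 - c`, for a
choice `w` of an anchor at each of these primes. The group `(𝓞 K)ˣ` acts coordinatewise. -/
abbrev SideBranchProduct (c : 𝓞 K) (w : ∀ P : BadPrimes c, Vertex P.1) : Type _ :=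
  ∀ P : BadPrimes c, SideBranch P.1 c (w P)

/-- The set of `(𝓞 K)ˣ`-orbits in the product of the side branches. -/
abbrev Orbits (c : 𝓞 K) (w : ∀ P : BadPrimes c, Vertex P.1) : Type _ :=
  MulAction.orbitRel.Quotient (𝓞 K)ˣ (SideBranchProduct c w)

end BruhatTits

end

noncomputable section

/-! Put `d = 1 - χ₀`. Orbits and classes are compared through the ring `𝓞_K / d`: the orbits
correspond to `(𝓞_K / d) / 𝓞_K^*`, and the conjugacy classes to the product of this set with the
class group.

Tree side. Let `D` be the valuation of `d` at `P`. A ball of centre `a` and exponent `n` lies in the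
side branch at the ball `(0, N)` exactly when `v(d a) ≥ n` and the smallest ball containing it and
`0` is `(0, N)` (`ballVertex_mem_sideBranch_iff`). Such vertices are the balls of centre `t / z` and
exponent `N + D - j`, for `z` integral of valuation `j < D` and `t` of valuation `N + j`, together
with `(0, N)` itself. The vertex determines exactly the residue of `z` modulo `P ^ D`
(`branchVertex_eq_iff`), and `z` stands in the denominator, so the map dividing by `u` becomes
multiplication by `u` on parameters. The Chinese remainder theorem assembles the branches into `𝓞_K
/ d`.

Representation side. The centraliser of `ρ_χ` is diagonal because `χ₀ ≠ 1`, so a class is a double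
coset of conjugating matrices `T`, by diagonal matrices on the left and `GL₂(𝓞_K)` on the right.
Each double coset contains `!![1, 0; e, 1] * M`, where `M` has determinant one and maps `𝓞_K²` onto
`I ⊕ I⁻¹`, with `I` a fixed ideal in a class determined by the coset. The conjugated representation
is integral exactly when `d e I² ⊆ 𝓞_K`, and `e` matters only modulo `I⁻²` and units. Choosing `I`
integral and coprime to `d` makes every admissible `e` congruent to some `z / d` with `z` in `𝓞_K`,
and leaves `z` modulo `d` up to units (`exists_surjective_classes`). -/

namespace BruhatTits

variable {K : Type*} [Field K] [NumberField K] {v : HeightOneSpectrum (𝓞 K)}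

/-! ### Balls of the completion and adjacency in the tree -/

/-- The vertex given by the ball `{z | v (z - a) ≤ exp (-n)}`. -/
def ballVertex (a : v.adicCompletion K) (n : ℤ) : Vertex v :=
  ⟨{z | Valued.v (z - a) ≤ (WithZero.exp (-n) : ℤᵐ⁰)}, a, n, rfl⟩

lemma mem_ballVertex {a z : v.adicCompletion K} {n : ℤ} :
    z ∈ (ballVertex a n).ball ↔ Valued.v (z - a) ≤ (WithZero.exp (-n) : ℤᵐ⁰) := Iff.rfl

lemma Vertex.exists_eq_ballVertex (x : Vertex v) : ∃ a n, x = ballVertex a n := by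
  obtain ⟨a, n, h⟩ := x.isBall
  exact ⟨a, n, Vertex.ext h⟩

lemma exp_neg_le_exp_neg {m n : ℤ} :
    (WithZero.exp (-n) : ℤᵐ⁰) ≤ WithZero.exp (-m) ↔ m ≤ n := by
  rw [WithZero.exp_le_exp]; omega

lemma ballVertex_le_iff {a b : v.adicCompletion K} {n m : ℤ} :
    ballVertex a n ≤ ballVertex b m ↔
      m ≤ n ∧ Valued.v (a - b) ≤ (WithZero.exp (-m) : ℤᵐ⁰) := by
  constructor
  · intro h
    have hsub : ∀ z, Valued.v (z - a) ≤ (WithZero.exp (-n) : ℤᵐ⁰) →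
        Valued.v (z - b) ≤ (WithZero.exp (-m) : ℤᵐ⁰) := fun z hz => h hz
    have hab := hsub a (by simp)
    refine ⟨?_, hab⟩
    -- An element of valuation exactly `exp (-n)` witnesses the radius, so the ball as a set
    -- determines its exponent.
    obtain ⟨p, hp⟩ := v.valuedAdicCompletion_surjective K (WithZero.exp (-n))
    have h1 := hsub (a + p) (by simp [hp])
    have h2 := Valuation.map_sub_le Valued.v h1 hab
    rw [show a + p - b - (a - b) = p by ring, hp] at h2
    exact exp_neg_le_exp_neg.1 h2
  · rintro ⟨hmn, hab⟩ z hz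
    have hz' : Valued.v (z - a) ≤ (WithZero.exp (-n) : ℤᵐ⁰) := hz
    have := Valuation.map_add_le Valued.v (hz'.trans (exp_neg_le_exp_neg.2 hmn)) hab
    rwa [sub_add_sub_cancel] at this

lemma ballVertex_eq_iff {a b : v.adicCompletion K} {n m : ℤ} :
    ballVertex a n = ballVertex b m ↔
      n = m ∧ Valued.v (a - b) ≤ (WithZero.exp (-n) : ℤᵐ⁰) := by
  rw [le_antisymm_iff, ballVertex_le_iff, ballVertex_le_iff]
  constructor
  · rintro ⟨⟨h1, h2⟩, h3, -⟩
    obtain rfl : n = m := le_antisymm h3 h1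
    exact ⟨rfl, h2⟩
  · rintro ⟨rfl, h⟩
    exact ⟨⟨le_rfl, h⟩, le_rfl, by rwa [Valuation.map_sub_swap]⟩

lemma ballVertex_covBy_iff {a b : v.adicCompletion K} {n m : ℤ} :
    ballVertex a n ⋖ ballVertex b m ↔
      n = m + 1 ∧ Valued.v (a - b) ≤ (WithZero.exp (-m) : ℤᵐ⁰) := by
  constructor
  · rintro ⟨hlt, hcov⟩
    obtain ⟨hmn, hab⟩ := ballVertex_le_iff.1 hlt.le
    have hb : ballVertex b m = ballVertex a m :=
      ballVertex_eq_iff.2 ⟨rfl, by rwa [Valuation.map_sub_swap]⟩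
    refine ⟨?_, hab⟩
    rw [hb] at hlt hcov
    by_contra hne
    have hnm : n ≠ m := by rintro rfl; exact lt_irrefl _ hlt
    refine hcov (c := ballVertex a (m + 1)) ?_ ?_ <;>
      rw [lt_iff_le_not_ge, ballVertex_le_iff, ballVertex_le_iff] <;>
      simp only [sub_self, map_zero, zero_le, and_true] <;> omega
  · rintro ⟨rfl, hab⟩
    have hb : ballVertex b m = ballVertex a m :=
      ballVertex_eq_iff.2 ⟨rfl, by rwa [Valuation.map_sub_swap]⟩
    rw [hb]
    constructor
    · rw [lt_iff_le_not_ge, ballVertex_le_iff, ballVertex_le_iff]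
      simp
    · intro x h1 h2
      obtain ⟨c, k, rfl⟩ := x.exists_eq_ballVertex
      obtain ⟨h3, h4⟩ := ballVertex_le_iff.1 h1.le
      have hc : ballVertex c k = ballVertex a k :=
        ballVertex_eq_iff.2 ⟨rfl, by rwa [Valuation.map_sub_swap]⟩
      rw [hc] at h1 h2
      obtain ⟨h5, -⟩ := ballVertex_le_iff.1 h2.le
      obtain rfl | rfl : k = m ∨ k = m + 1 := by omega
      · exact lt_irrefl _ h2
      · exact lt_irrefl _ h1

lemma exists_walk_ballVertex (a : v.adicCompletion K) (n : ℤ) (k : ℕ) :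
    ∃ p : (tree v).Walk (ballVertex a (n + k)) (ballVertex a n), p.length = k := by
  induction k with
  | zero => exact ⟨SimpleGraph.Walk.nil.copy (by simp) rfl, by simp⟩
  | succ k ih =>
    obtain ⟨p, hp⟩ := ih
    have hadj : (tree v).Adj (ballVertex a (n + (k + 1 : ℕ))) (ballVertex a (n + k)) :=
      Or.inl (ballVertex_covBy_iff.2 ⟨by push_cast; ring, by simp⟩)
    exact ⟨SimpleGraph.Walk.cons hadj p, by simp [hp]⟩

lemma tree_reachable (x y : Vertex v) : (tree v).Reachable x y := by
  obtain ⟨a, n, rfl⟩ := x.exists_eq_ballVertex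
  obtain ⟨b, m, rfl⟩ := y.exists_eq_ballVertex
  have key : ∀ (a : v.adicCompletion K) (n l : ℤ), l ≤ n →
      (tree v).Reachable (ballVertex a n) (ballVertex a l) := by
    intro a n l hl
    obtain ⟨p, -⟩ := exists_walk_ballVertex a l (n - l).toNat
    rw [show l + ((n - l).toNat : ℤ) = n by omega] at p
    exact ⟨p⟩
  -- Both balls are contained in one ball of exponent `l`, and the path climbs to it from either
  -- end. Equal centres are treated apart, since the logarithm of `0` is a default value.
  obtain ⟨l, hln, hlm, hab⟩ : ∃ l : ℤ, l ≤ n ∧ l ≤ m ∧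
      Valued.v (a - b) ≤ (WithZero.exp (-l) : ℤᵐ⁰) := by
    by_cases h : Valued.v (a - b) = 0
    · exact ⟨min n m, min_le_left _ _, min_le_right _ _, by simp [h]⟩
    · refine ⟨min (min n m) (-WithZero.log (Valued.v (a - b))), by omega, by omega, ?_⟩
      rw [← WithZero.exp_log h, WithZero.exp_le_exp, WithZero.exp_log h]
      omega
  have := ballVertex_eq_iff.2 ⟨rfl, hab⟩
  exact (key a n l hln).trans (this ▸ (key b m l hlm).symm)

/-! ### Anchors -/

lemma mem_apartment_iff {a : v.adicCompletion K} {n : ℤ} :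
    ballVertex a n ∈ apartment v ↔ ballVertex a n = ballVertex 0 n := by
  rw [ballVertex_eq_iff, sub_zero]
  change Valued.v (0 - a) ≤ _ ↔ _
  simp

lemma exists_eq_ballVertex_zero {w : Vertex v} (hw : w ∈ apartment v) :
    ∃ n, w = ballVertex 0 n := by
  obtain ⟨a, n, rfl⟩ := w.exists_eq_ballVertex
  exact ⟨n, mem_apartment_iff.1 hw⟩

/-- The exponent of the smallest ball containing both the ball `(a, n)` and `0`. -/
lemma exists_max_eq_exp (a : v.adicCompletion K) (n : ℤ) :
    ∃ m ≤ n, max (WithZero.exp (-n) : ℤᵐ⁰) (Valued.v a) = WithZero.exp (-m) := by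
  rcases le_total (Valued.v a) (WithZero.exp (-n) : ℤᵐ⁰) with h | h
  · exact ⟨n, le_rfl, max_eq_left h⟩
  · have h0 : Valued.v a ≠ 0 := fun h0 => by simp [h0] at h
    refine ⟨-WithZero.log (Valued.v a), ?_, by rw [max_eq_right h, neg_neg, WithZero.exp_log h0]⟩
    rw [← WithZero.exp_log h0, WithZero.exp_le_exp] at h
    omega

/-- Along an edge either the smallest ball containing `0` is unchanged, or both ends lie on
the standard apartment. -/
lemma max_exponent_of_covBy {a b : v.adicCompletion K} {n m k l : ℤ}
    (h : ballVertex a n ⋖ ballVertex b m)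
    (hk : max (WithZero.exp (-n) : ℤᵐ⁰) (Valued.v a) = WithZero.exp (-k))
    (hl : max (WithZero.exp (-m) : ℤᵐ⁰) (Valued.v b) = WithZero.exp (-l)) :
    k = l ∨ (k = n ∧ l = m) := by
  obtain ⟨rfl, hab⟩ := ballVertex_covBy_iff.1 h
  have hlt : (WithZero.exp (-(m + 1)) : ℤᵐ⁰) < WithZero.exp (-m) := by
    rw [WithZero.exp_lt_exp]; omega
  have hinj : ∀ {i j : ℤ}, (WithZero.exp (-i) : ℤᵐ⁰) = WithZero.exp (-j) → i = j := by
    intro i j hij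
    have := WithZero.exp_injective hij
    omega
  by_cases hb : Valued.v b ≤ (WithZero.exp (-m) : ℤᵐ⁰)
  · have hm : l = m := hinj (by rw [← hl, max_eq_left hb])
    have ha : Valued.v a ≤ (WithZero.exp (-m) : ℤᵐ⁰) := by
      simpa using Valuation.map_add_le Valued.v hab hb
    subst hm
    have h1 : l ≤ k := exp_neg_le_exp_neg.1 (hk ▸ max_le hlt.le ha)
    have h2 : k ≤ l + 1 := exp_neg_le_exp_neg.1 (hk ▸ le_max_left _ _)
    omega
  · push Not at hb
    have hva : Valued.v a = Valued.v b := by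
      have := Valuation.map_add_eq_of_lt_right Valued.v (hab.trans_lt hb)
      rwa [sub_add_cancel] at this
    left
    apply hinj
    rw [← hk, ← hl, hva, max_eq_right hb.le, max_eq_right (hlt.trans hb).le]

/-- The left-hand side vanishes at the end of the walk and drops by at most one along an edge: by
`max_exponent_of_covBy`, either `m` is fixed and `n` moves by one, or both ends lie on the
apartment, where `n = m`. -/
lemma le_length_walk {x y : Vertex v} (p : (tree v).Walk x y) {n' : ℤ}
    (hy : y = ballVertex 0 n') {a : v.adicCompletion K} {n m : ℤ} (hx : x = ballVertex a n)
    (hm : max (WithZero.exp (-n) : ℤᵐ⁰) (Valued.v a) = WithZero.exp (-m)) :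
    (n - m) + |n' - m| ≤ p.length := by
  induction p generalizing a n m with
  | nil =>
    obtain ⟨rfl, h⟩ := ballVertex_eq_iff.1 (hx.symm.trans hy)
    rw [sub_zero] at h
    rw [max_eq_left h] at hm
    have := WithZero.exp_injective hm
    obtain rfl : n = m := by omega
    simp
  | @cons x z y hadj p ih =>
    obtain ⟨b, k, rfl⟩ := z.exists_eq_ballVertex
    obtain ⟨l, -, hl⟩ := exists_max_eq_exp b k
    have h1 := ih hy rfl hl
    subst hx
    rw [SimpleGraph.Walk.length_cons, Nat.cast_add, Nat.cast_one]
    rcases hadj with h | h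
    · have h2 := (ballVertex_covBy_iff.1 h).1
      have h3 := max_exponent_of_covBy h hm hl
      have h4 := abs_sub_le n' l m
      have h5 : |l - m| ≤ 1 ∧ (m ≠ l → |l - m| = 1) := by
        rcases h3 with h3 | h3
        · simp [h3]
        · have : l - m = -1 := by omega
          simp [this]
      rcases h3 with h3 | h3
      · subst h3; omega
      · omega
    · have h2 := (ballVertex_covBy_iff.1 h).1
      have h3 := max_exponent_of_covBy h hl hm
      have h4 := abs_sub_le n' l m
      rcases h3 with h3 | h3
      · subst h3; omega
      · have : |l - m| = 1 := by
          have : l - m = 1 := by omega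
          simp [this]
        omega

lemma dist_ballVertex_zero (a : v.adicCompletion K) (n m : ℤ) (n' : ℤ)
    (hm : max (WithZero.exp (-n) : ℤᵐ⁰) (Valued.v a) = WithZero.exp (-m)) :
    (n - m) + |n' - m| ≤ (tree v).dist (ballVertex a n) (ballVertex 0 n') := by
  obtain ⟨p, hp⟩ := (tree_reachable (ballVertex a n) (ballVertex 0 n')).exists_walk_length_eq_dist
  rw [← hp]
  exact le_length_walk p rfl rfl hm

/-- Enlarging the ball until it contains `0` is a path of length `n - m`. The lower bound on
distances exceeds this at every other vertex of the apartment, so the anchor is unique. -/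
lemma isAnchor_ballVertex_iff {a : v.adicCompletion K} {n N : ℤ} :
    IsAnchor (ballVertex a n) (ballVertex 0 N) ↔
      max (WithZero.exp (-n) : ℤᵐ⁰) (Valued.v a) = WithZero.exp (-N) := by
  obtain ⟨m, hmn, hm⟩ := exists_max_eq_exp a n
  have hle : ((tree v).dist (ballVertex a n) (ballVertex 0 m) : ℤ) ≤ n - m := by
    obtain ⟨p, hp⟩ := exists_walk_ballVertex a m (n - m).toNat
    have hd := SimpleGraph.dist_le p
    rw [hp, show m + ((n - m).toNat : ℤ) = n by omega] at hd
    have h0 : ballVertex a m = ballVertex 0 m :=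
      ballVertex_eq_iff.2 ⟨rfl, by rw [sub_zero, ← hm]; exact le_max_right _ _⟩
    rw [← h0]
    omega
  have hap : ∀ k : ℤ, (ballVertex 0 k : Vertex v) ∈ apartment v :=
    fun k => mem_apartment_iff.2 rfl
  rw [hm]
  constructor
  · rintro ⟨-, h⟩
    have h1 := h _ (hap m)
    have h2 := dist_ballVertex_zero a n m N hm
    have h3 : |N - m| ≤ 0 := by omega
    rw [abs_nonpos_iff] at h3
    rw [show m = N by omega]
  · intro h
    have := WithZero.exp_injective h
    obtain rfl : m = N := by omega
    refine ⟨hap m, fun w' hw' => ?_⟩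
    obtain ⟨n', rfl⟩ := exists_eq_ballVertex_zero hw'
    have h2 := dist_ballVertex_zero a n m n' hm
    have h3 := abs_nonneg (n' - m)
    omega

/-! ### Side branches -/

lemma valued_algebraMap_le_one (c : 𝓞 K) :
    Valued.v (algebraMap (𝓞 K) (v.adicCompletion K) c) ≤ (1 : ℤᵐ⁰) :=
  v.coe_mem_adicCompletionIntegers (K := K) c

lemma mem_lattice_ballVertex {a : v.adicCompletion K} {n : ℤ} {w : Fin 2 → v.adicCompletion K}
    (hw : w ∈ (ballVertex a n).lattice) :
    Valued.v (w 1) ≤ (1 : ℤᵐ⁰) ∧ Valued.v (w 0 - a * w 1) ≤ (WithZero.exp (-n) : ℤᵐ⁰) := by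
  induction hw using Submodule.span_induction with
  | mem w hw =>
    obtain ⟨b, hb, rfl⟩ := hw
    exact ⟨by simp, by simpa using mem_ballVertex.1 hb⟩
  | zero => simp
  | add w w' _ _ h h' =>
    refine ⟨Valuation.map_add_le Valued.v h.1 h'.1, ?_⟩
    have := Valuation.map_add_le Valued.v h.2 h'.2
    rwa [show w 0 - a * w 1 + (w' 0 - a * w' 1) = (w + w') 0 - a * (w + w') 1 by
      simp only [Pi.add_apply]; ring] at this
  | smul r w _ h =>
    have hr : Valued.v (r : v.adicCompletion K) ≤ (1 : ℤᵐ⁰) := r.2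
    have e : ∀ i, (r • w) i = (r : v.adicCompletion K) * w i := fun i => rfl
    refine ⟨by rw [e, map_mul]; exact mul_le_one' hr h.1, ?_⟩
    rw [e, e, show (r : v.adicCompletion K) * w 0 - a * (r * w 1) = r * (w 0 - a * w 1) by ring,
      map_mul]
    exact (mul_le_of_le_one_left' hr).trans h.2

/-- The image of `(b, 1)` is `(b, c) = c (b, 1) + ((1 - c) b, 0)`, so stability of the lattice means
that translation by `(1 - c) b` preserves the ball; it suffices to test `b = a`. -/
lemma diagMat_mem_maximalOrder_iff {c : 𝓞 K} {a : v.adicCompletion K} {n : ℤ} :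
    diagMat v c ∈ (ballVertex a n).maximalOrder ↔
      Valued.v (algebraMap (𝓞 K) (v.adicCompletion K) (1 - c) * a) ≤
        (WithZero.exp (-n) : ℤᵐ⁰) := by
  have hD : ∀ b : v.adicCompletion K, (diagMat v c).mulVec ![b, 1] =
      ![b, algebraMap (𝓞 K) (v.adicCompletion K) c] := by
    intro b
    funext i
    fin_cases i <;> simp [diagMat]
  constructor
  · intro h
    have h1 := h ![a, 1] (Submodule.subset_span ⟨a, by simp [mem_ballVertex], rfl⟩)
    rw [hD] at h1
    have h2 := (mem_lattice_ballVertex h1).2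
    convert h2 using 2
    simp
    ring
  · intro h w hw
    have hc1 : Valued.v (algebraMap (𝓞 K) (v.adicCompletion K) (1 - c)) ≤ (1 : ℤᵐ⁰) :=
      valued_algebraMap_le_one _
    induction hw using Submodule.span_induction with
    | mem w hw =>
      obtain ⟨b, hb, rfl⟩ := hw
      have hb' : Valued.v (b - a) ≤ (WithZero.exp (-n) : ℤᵐ⁰) := hb
      set d := algebraMap (𝓞 K) (v.adicCompletion K) (1 - c) with hd
      have hdb : Valued.v (d * b) ≤ (WithZero.exp (-n) : ℤᵐ⁰) := by
        have h2 : Valued.v (d * (b - a)) ≤ (WithZero.exp (-n) : ℤᵐ⁰) := by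
          rw [map_mul]; exact (mul_le_of_le_one_left' hc1).trans hb'
        have := Valuation.map_add_le Valued.v h2 h
        rwa [← mul_add, sub_add_cancel] at this
      have hmem : b + d * b ∈ (ballVertex a n).ball := by
        have := Valuation.map_add_le Valued.v hb' hdb
        rwa [sub_add_eq_add_sub] at this
      -- The vector `(d b, 0)` is written as a difference of two generators, which avoids choosing a
      -- uniformizer.
      have h3 : (diagMat v c).mulVec ![b, 1] =
          (algebraMap (𝓞 K) (v.adicCompletionIntegers K) c) • ![b, 1] +
            (![b + d * b, 1] - ![b, 1]) := by
        rw [hD]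
        funext i
        fin_cases i
        · change b = algebraMap (𝓞 K) (v.adicCompletion K) c * b + (b + d * b - b)
          rw [hd, map_sub, map_one]; ring
        · change _ = algebraMap (𝓞 K) (v.adicCompletion K) c * 1 + (1 - 1)
          simp
      rw [h3]
      refine add_mem (Submodule.smul_mem _ _ (Submodule.subset_span ⟨b, hb, rfl⟩)) (sub_mem ?_ ?_)
      · exact Submodule.subset_span ⟨_, hmem, rfl⟩
      · exact Submodule.subset_span ⟨_, hb, rfl⟩
    | zero => simp
    | add w w' _ _ h h' => rw [Matrix.mulVec_add]; exact add_mem h h'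
    | smul r w _ h =>
      rw [show (diagMat v c).mulVec (r • w) = r • (diagMat v c).mulVec w from
        Matrix.mulVec_smul _ r w]
      exact Submodule.smul_mem _ _ h

lemma ballVertex_mem_sideBranch_iff {c : 𝓞 K} {a : v.adicCompletion K} {n N : ℤ} :
    ballVertex a n ∈ SideBranch v c (ballVertex 0 N) ↔
      Valued.v (algebraMap (𝓞 K) (v.adicCompletion K) (1 - c) * a) ≤
        (WithZero.exp (-n) : ℤᵐ⁰) ∧
      max (WithZero.exp (-n) : ℤᵐ⁰) (Valued.v a) = WithZero.exp (-N) :=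
  and_congr diagMat_mem_maximalOrder_iff isAnchor_ballVertex_iff

lemma smul_ballVertex (u : (𝓞 K)ˣ) (a : v.adicCompletion K) (n : ℤ) :
    u • ballVertex a n =
      ballVertex (a / algebraMap (𝓞 K) (v.adicCompletion K) (u : 𝓞 K)) n := by
  have hu := unit_ne_zero v u
  apply Vertex.ext
  ext z
  rw [smul_ball, Set.mem_image, mem_ballVertex]
  constructor
  · rintro ⟨y, hy, rfl⟩
    rwa [← sub_div, map_div₀, valued_unit, div_one]
  · intro hz
    refine ⟨z * algebraMap (𝓞 K) (v.adicCompletion K) u, ?_, by field_simp⟩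
    rw [mem_ballVertex, show z * algebraMap (𝓞 K) (v.adicCompletion K) u - a =
      (z - a / algebraMap (𝓞 K) (v.adicCompletion K) u) *
        algebraMap (𝓞 K) (v.adicCompletion K) u by field_simp, map_mul, valued_unit, mul_one]
    exact hz

/-! ### A parametrisation of a side branch by algebraic integers -/

lemma exists_integer_near {y : v.adicCompletion K} (hy : Valued.v y ≤ (1 : ℤᵐ⁰)) (D : ℤ) :
    ∃ z : 𝓞 K, Valued.v (algebraMap (𝓞 K) (v.adicCompletion K) z - y) ≤
      (WithZero.exp (-D) : ℤᵐ⁰) := by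
  -- The bound `min (-D) 0` makes the approximation `k` in `K` both close to `y` and integral at
  -- `v`; then `k` is in turn approximated by an algebraic integer.
  obtain ⟨e, he⟩ := v.valuedAdicCompletion_surjective K (WithZero.exp (min (-D) 0))
  have he0 : Valued.v.restrict e ≠ 0 := by
    intro h
    rw [Valuation.restrict_eq_zero_iff] at h
    rw [h] at he
    exact WithZero.exp_ne_zero he.symm
  have hnhds : {x | Valued.v (x - y) < (WithZero.exp (min (-D) 0) : ℤᵐ⁰)} ∈ nhds y := by
    rw [Valued.mem_nhds]
    refine ⟨Units.mk0 _ he0, fun x hx => ?_⟩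
    rw [Units.val_mk0, Set.mem_ofPred_eq, Valuation.restrict_lt_iff, he] at hx
    exact hx
  obtain ⟨k, hk⟩ := (v.denseRange_algebraMap (K := K)).exists_mem_open
    isOpen_interior ⟨y, mem_interior_iff_mem_nhds.2 hnhds⟩
  have hk : Valued.v (algebraMap K (v.adicCompletion K) k - y) <
      (WithZero.exp (min (-D) 0) : ℤᵐ⁰) :=
    (interior_subset hk : _ ∈ {x | Valued.v (x - y) < (WithZero.exp (min (-D) 0) : ℤᵐ⁰)})
  have hk1 : v.valuation K k ≤ 1 := by
    rw [← HeightOneSpectrum.valuedAdicCompletion_eq_valuation']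
    have h1 : (WithZero.exp (min (-D) 0) : ℤᵐ⁰) ≤ 1 := by
      rw [← WithZero.exp_zero, WithZero.exp_le_exp]; exact min_le_right _ _
    have := Valuation.map_add_le Valued.v (hk.le.trans h1) hy
    rwa [sub_add_cancel] at this
  obtain ⟨z, hz⟩ := v.exists_valuation_sub_lt_of_integer hk1
    (Units.mk0 (WithZero.exp (-D) : ℤᵐ⁰) WithZero.exp_ne_zero)
  refine ⟨z, ?_⟩
  rw [← HeightOneSpectrum.valuedAdicCompletion_eq_valuation', Units.val_mk0] at hz
  have h2 : (WithZero.exp (min (-D) 0) : ℤᵐ⁰) ≤ WithZero.exp (-D) := by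
    rw [WithZero.exp_le_exp]; exact min_le_left _ _
  have hcast : ((algebraMap (𝓞 K) K z - k : K) : v.adicCompletion K) =
      algebraMap (𝓞 K) (v.adicCompletion K) z - algebraMap K (v.adicCompletion K) k := by
    rw [IsScalarTower.algebraMap_apply (𝓞 K) K (v.adicCompletion K), ← map_sub]
    rfl
  rw [hcast] at hz
  have := Valuation.map_add_le Valued.v hz.le (hk.le.trans h2)
  rwa [sub_add_sub_cancel] at this

/-- A set-theoretic section of the valuation of the completion. -/
def valuedSection (v : HeightOneSpectrum (𝓞 K)) (γ : ℤᵐ⁰) : v.adicCompletion K :=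
  (v.valuedAdicCompletion_surjective K γ).choose

lemma valued_valuedSection (γ : ℤᵐ⁰) : Valued.v (valuedSection v γ) = γ :=
  (v.valuedAdicCompletion_surjective K γ).choose_spec

open Classical in
/-- The vertex of the side branch at the ball `(0, N)` with parameter `z`, where `D` is the depth
of the branch: it is `(0, N)` itself when `z` has additive valuation at least `D`, and otherwise
the ball around `ϖ ^ N * (ϖ ^ v(z) / z)` at depth `D - v(z)` below `(0, N)`. -/
def branchVertex (N D : ℤ) (z : v.adicCompletion K) : Vertex v :=
  if Valued.v z ≤ (WithZero.exp (-D) : ℤᵐ⁰) then ballVertex 0 N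
  else ballVertex (valuedSection v (WithZero.exp (-N) * Valued.v z) / z)
    (N + D + WithZero.log (Valued.v z))

lemma branchVertex_of_le {N D : ℤ} {z : v.adicCompletion K}
    (h : Valued.v z ≤ (WithZero.exp (-D) : ℤᵐ⁰)) : branchVertex N D z = ballVertex 0 N :=
  if_pos h

lemma branchVertex_of_eq_exp {N D j : ℤ} {z : v.adicCompletion K}
    (h : Valued.v z = (WithZero.exp (-j) : ℤᵐ⁰)) (hj : j < D) :
    branchVertex N D z = ballVertex (valuedSection v (WithZero.exp (-(N + j))) / z)
      (N + D - j) := by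
  have h1 : ¬ Valued.v z ≤ (WithZero.exp (-D) : ℤᵐ⁰) := by
    rw [h, exp_neg_le_exp_neg]; omega
  rw [branchVertex, if_neg h1, h, ← WithZero.exp_add, WithZero.log_exp]
  congr 3
  · congr 1; ring

lemma le_exp_or_eq_exp (D : ℤ) (z : v.adicCompletion K) :
    Valued.v z ≤ (WithZero.exp (-D) : ℤᵐ⁰) ∨
      ∃ j < D, Valued.v z = (WithZero.exp (-j) : ℤᵐ⁰) := by
  by_cases h : Valued.v z ≤ (WithZero.exp (-D) : ℤᵐ⁰)
  · exact Or.inl h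
  · right
    have h0 : Valued.v z ≠ 0 := fun h0 => h (by simp [h0])
    refine ⟨-WithZero.log (Valued.v z), ?_, by rw [neg_neg, WithZero.exp_log h0]⟩
    rw [← WithZero.exp_log h0, WithZero.exp_le_exp] at h
    omega

lemma ne_zero_of_valued_eq_exp {z : v.adicCompletion K} {j : ℤ}
    (h : Valued.v z = (WithZero.exp j : ℤᵐ⁰)) : z ≠ 0 := by
  rintro rfl
  rw [map_zero] at h
  exact WithZero.exp_ne_zero h.symm

lemma valued_section_div {N j : ℤ} {z : v.adicCompletion K}
    (h : Valued.v z = (WithZero.exp (-j) : ℤᵐ⁰)) :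
    Valued.v (valuedSection v (WithZero.exp (-(N + j))) / z) = (WithZero.exp (-N) : ℤᵐ⁰) := by
  rw [map_div₀, valued_valuedSection, h, ← WithZero.exp_sub]
  congr 1; ring

lemma branchVertex_mem_sideBranch {c : 𝓞 K} {N D : ℤ}
    (hD : Valued.v (algebraMap (𝓞 K) (v.adicCompletion K) (1 - c)) = (WithZero.exp (-D) : ℤᵐ⁰))
    {z : v.adicCompletion K} (hz : Valued.v z ≤ (1 : ℤᵐ⁰)) :
    branchVertex N D z ∈ SideBranch v c (ballVertex 0 N) := by
  rcases le_exp_or_eq_exp D z with h | ⟨j, hj, h⟩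
  · rw [branchVertex_of_le h, ballVertex_mem_sideBranch_iff]
    simp
  · rw [branchVertex_of_eq_exp h hj, ballVertex_mem_sideBranch_iff, map_mul, hD,
      valued_section_div h, ← WithZero.exp_add, WithZero.exp_le_exp]
    rw [h, ← WithZero.exp_zero, WithZero.exp_le_exp] at hz
    refine ⟨by omega, max_eq_right ?_⟩
    rw [exp_neg_le_exp_neg]; omega

/-- When `z` and `z'` have the same valuation `j < D`, the same numerator `t` serves both, and `t /
z - t / z' = t (z' - z) / (z z')` has valuation `v(z - z') + N - j`, to be compared with `N + D -
j`. Different valuations below `D` give different exponents. -/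
lemma branchVertex_eq_iff {N D : ℤ} {z z' : v.adicCompletion K} :
    branchVertex N D z = branchVertex N D z' ↔
      Valued.v (z - z') ≤ (WithZero.exp (-D) : ℤᵐ⁰) := by
  have hne : ∀ {z z' : v.adicCompletion K} {j : ℤ}, j < D →
      Valued.v z = (WithZero.exp (-j) : ℤᵐ⁰) → Valued.v z' ≤ (WithZero.exp (-D) : ℤᵐ⁰) →
      branchVertex N D z ≠ branchVertex N D z' ∧
        ¬ Valued.v (z - z') ≤ (WithZero.exp (-D) : ℤᵐ⁰) := by
    intro z z' j hj h h'
    constructor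
    · rw [branchVertex_of_eq_exp h hj, branchVertex_of_le h', ne_eq, ballVertex_eq_iff]
      omega
    · intro h1
      have := Valuation.map_add_le Valued.v h1 h'
      rw [sub_add_cancel, h, exp_neg_le_exp_neg] at this
      omega
  rcases le_exp_or_eq_exp D z with h | ⟨j, hj, h⟩ <;>
    rcases le_exp_or_eq_exp D z' with h' | ⟨j', hj', h'⟩
  · rw [branchVertex_of_le h, branchVertex_of_le h']
    exact iff_of_true rfl (Valuation.map_sub_le Valued.v h h')
  · have := hne hj' h' h
    exact iff_of_false this.1.symm (by rw [Valuation.map_sub_swap]; exact this.2)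
  · exact iff_of_false (hne hj h h').1 (hne hj h h').2
  · have hz0 := ne_zero_of_valued_eq_exp h
    have hz0' := ne_zero_of_valued_eq_exp h'
    rw [branchVertex_of_eq_exp h hj, branchVertex_of_eq_exp h' hj', ballVertex_eq_iff]
    by_cases hjj : j = j'
    · subst hjj
      set t := valuedSection v (WithZero.exp (-(N + j))) with ht
      have ht0 : Valued.v t = (WithZero.exp (-(N + j)) : ℤᵐ⁰) := valued_valuedSection _
      rw [show t / z - t / z' = t * (z' - z) / (z * z') by
          have := hz0; have := hz0'; field_simp,
        map_div₀, map_mul, map_mul, h, h', ht0, Valuation.map_sub_swap,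
        div_le_iff₀ (by simp), ← WithZero.exp_add, ← WithZero.exp_add,
        show (-(N + D - j) + (-j + -j) : ℤ) = -(N + j) + -D by ring,
        WithZero.exp_add, mul_le_mul_iff_right₀ (by simp)]
      simp
    · refine iff_of_false (fun h1 => hjj (by omega)) fun h1 => ?_
      have hlt : Valued.v (z - z') < Valued.v z' := by
        refine h1.trans_lt ?_
        rw [h', WithZero.exp_lt_exp]; omega
      have := Valuation.map_add_eq_of_lt_left Valued.v hlt
      rw [add_sub_cancel, h, h'] at this
      have := WithZero.exp_injective this
      omega

lemma exists_branchVertex_eq {c : 𝓞 K} {N D : ℤ}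
    (hD : Valued.v (algebraMap (𝓞 K) (v.adicCompletion K) (1 - c)) = (WithZero.exp (-D) : ℤᵐ⁰))
    {x : Vertex v} (hx : x ∈ SideBranch v c (ballVertex 0 N)) :
    ∃ z : 𝓞 K, branchVertex N D (algebraMap (𝓞 K) (v.adicCompletion K) z) = x := by
  obtain ⟨a, n, rfl⟩ := x.exists_eq_ballVertex
  obtain ⟨h1, h2⟩ := ballVertex_mem_sideBranch_iff.1 hx
  by_cases ha : Valued.v a ≤ (WithZero.exp (-n) : ℤᵐ⁰)
  · rw [max_eq_left ha] at h2
    have := WithZero.exp_injective h2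
    obtain rfl : n = N := by omega
    refine ⟨0, ?_⟩
    rw [branchVertex_of_le (by simp), ballVertex_eq_iff]
    simpa using ha
  · push Not at ha
    rw [max_eq_right ha.le] at h2
    have hnN : N < n := by
      rw [h2, WithZero.exp_lt_exp] at ha; omega
    have ha0 := ne_zero_of_valued_eq_exp h2
    rw [map_mul, hD, h2, ← WithZero.exp_add, WithZero.exp_le_exp] at h1
    -- This solves `n = N + D - j`. The condition `v(d a) ≥ n` says `j ≥ 0`, so `t / a` is integral
    -- and an algebraic integer approximates it modulo `P ^ D`.
    set j : ℤ := N + D - n with hj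
    set t := valuedSection v (WithZero.exp (-(N + j))) with ht
    have hta : Valued.v (t / a) = (WithZero.exp (-j) : ℤᵐ⁰) := by
      rw [map_div₀, ht, valued_valuedSection, h2, ← WithZero.exp_sub]
      congr 1; ring
    have hta1 : Valued.v (t / a) ≤ (1 : ℤᵐ⁰) := by
      rw [hta, ← WithZero.exp_zero, WithZero.exp_le_exp]; omega
    obtain ⟨z, hz⟩ := exists_integer_near hta1 D
    refine ⟨z, ?_⟩
    rw [branchVertex_eq_iff.2 hz, branchVertex_of_eq_exp hta (by omega), ballVertex_eq_iff]
    have ht0 : t ≠ 0 := ne_zero_of_valued_eq_exp (valued_valuedSection _)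
    refine ⟨by omega, ?_⟩
    rw [← ht, div_div_cancel₀ ht0]
    simp

/-- A unit does not change the valuation of `z`, so the numerator stays the same and `(t / z) / u =
t / (u z)`. -/
lemma smul_branchVertex (u : (𝓞 K)ˣ) (N D : ℤ) (z : v.adicCompletion K) :
    u • branchVertex N D z =
      branchVertex N D (algebraMap (𝓞 K) (v.adicCompletion K) (u : 𝓞 K) * z) := by
  have hv : Valued.v (algebraMap (𝓞 K) (v.adicCompletion K) (u : 𝓞 K) * z) = Valued.v z := by
    rw [map_mul, valued_unit, one_mul]
  rcases le_exp_or_eq_exp D z with h | ⟨j, hj, h⟩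
  · rw [branchVertex_of_le h, branchVertex_of_le (hv.trans_le h), smul_ballVertex, zero_div]
  · rw [branchVertex_of_eq_exp h hj, branchVertex_of_eq_exp (hv.trans h) hj, smul_ballVertex,
      div_div, mul_comm]

/-! ### The product of the side branches -/

lemma exists_valued_eq_exp_neg (P : HeightOneSpectrum (𝓞 K)) {d : 𝓞 K} (hd : d ≠ 0) :
    ∃ n : ℕ, Valued.v (algebraMap (𝓞 K) (P.adicCompletion K) d) =
      (WithZero.exp (-(n : ℤ)) : ℤᵐ⁰) := by
  refine ⟨(Associates.mk P.asIdeal).count (Associates.mk (Ideal.span {d})).factors, ?_⟩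
  rw [← P.intValuation_if_neg hd, ← P.valuation_of_algebraMap (K := K)]
  exact HeightOneSpectrum.valuedAdicCompletion_eq_valuation P d

lemma valued_algebraMap_le_exp_iff (P : HeightOneSpectrum (𝓞 K)) (z : 𝓞 K) (n : ℕ) :
    Valued.v (algebraMap (𝓞 K) (P.adicCompletion K) z) ≤ (WithZero.exp (-(n : ℤ)) : ℤᵐ⁰) ↔
      z ∈ P.asIdeal ^ n := by
  rw [← P.intValuation_le_pow_iff_mem, ← P.valuation_of_algebraMap (K := K)]
  exact iff_of_eq (congrArg (· ≤ _) (HeightOneSpectrum.valuedAdicCompletion_eq_valuation P z))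

lemma dvd_of_forall_valuation_le {d z : 𝓞 K} (hd : d ≠ 0)
    (h : ∀ P : HeightOneSpectrum (𝓞 K), P.intValuation z ≤ P.intValuation d) : d ∣ z := by
  have hd' : algebraMap (𝓞 K) K d ≠ 0 := by simpa using hd
  obtain ⟨y, hy⟩ := HeightOneSpectrum.mem_integers_of_valuation_le_one K
    (algebraMap (𝓞 K) K z / algebraMap (𝓞 K) K d) fun P => by
      rw [map_div₀, P.valuation_of_algebraMap, P.valuation_of_algebraMap]
      exact div_le_one_of_le₀ (h P) zero_le
  refine ⟨y, FaithfulSMul.algebraMap_injective (𝓞 K) K ?_⟩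
  rw [map_mul, hy]
  field_simp

lemma finite_badPrimes {c : 𝓞 K} (hc : c ≠ 1) : Finite (BadPrimes c) := by
  have : Ideal.span {1 - c} ≠ ⊥ := by
    rw [ne_eq, Ideal.span_singleton_eq_bot]; exact sub_ne_zero.2 hc.symm
  exact (Ideal.finite_factors this).to_subtype

lemma intValuation_eq_one_of_not_dvd (P : HeightOneSpectrum (𝓞 K)) {d : 𝓞 K}
    (h : ¬ P.asIdeal ∣ Ideal.span {d}) : P.intValuation d = 1 := by
  refine le_antisymm (P.intValuation_le_one d) (not_lt.1 fun hlt => h ?_)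
  exact (P.intValuation_lt_one_iff_dvd d).1 hlt

/-- The exponent of the prime `P` in `1 - c`. -/
def depth {c : 𝓞 K} (hc : c ≠ 1) (P : HeightOneSpectrum (𝓞 K)) : ℕ :=
  (exists_valued_eq_exp_neg P (sub_ne_zero.2 hc.symm)).choose

lemma valued_one_sub {c : 𝓞 K} (hc : c ≠ 1) (P : HeightOneSpectrum (𝓞 K)) :
    Valued.v (algebraMap (𝓞 K) (P.adicCompletion K) (1 - c)) =
      (WithZero.exp (-(depth hc P : ℤ)) : ℤᵐ⁰) :=
  (exists_valued_eq_exp_neg P (sub_ne_zero.2 hc.symm)).choose_spec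

variable {c : 𝓞 K} {w : ∀ P : BadPrimes c, Vertex P.1} {N : BadPrimes c → ℤ}

/-- The point of the product of the side branches at the balls `(0, N P)` with parameter `z`. -/
def branchPoint (hc : c ≠ 1) (hw : ∀ P, w P = ballVertex 0 (N P)) (z : 𝓞 K) :
    SideBranchProduct c w := fun P =>
  ⟨branchVertex (N P) (depth hc P.1) (algebraMap (𝓞 K) (P.1.adicCompletion K) z),
    hw P ▸ branchVertex_mem_sideBranch (valued_one_sub hc P.1) (valued_algebraMap_le_one z)⟩

/-- Equality at a bad prime is congruence modulo its full power in `1 - c`; at the other primes `1 -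
c` has valuation one and imposes nothing. -/
lemma branchPoint_eq_iff (hc : c ≠ 1) (hw : ∀ P, w P = ballVertex 0 (N P)) (z z' : 𝓞 K) :
    branchPoint hc hw z = branchPoint hc hw z' ↔ 1 - c ∣ z - z' := by
  have h1 : branchPoint hc hw z = branchPoint hc hw z' ↔ ∀ P : BadPrimes c,
      Valued.v (algebraMap (𝓞 K) (P.1.adicCompletion K) (z - z')) ≤
        (Valued.v (algebraMap (𝓞 K) (P.1.adicCompletion K) (1 - c)) : ℤᵐ⁰) := by
    rw [funext_iff]
    refine forall_congr' fun P => ?_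
    rw [Subtype.ext_iff, valued_one_sub hc, map_sub]
    exact branchVertex_eq_iff
  rw [h1]
  constructor
  · intro h
    refine dvd_of_forall_valuation_le (sub_ne_zero.2 hc.symm) fun P => ?_
    by_cases hP : P.asIdeal ∣ Ideal.span {1 - c}
    · have := h ⟨P, hP⟩
      rw [← P.valuation_of_algebraMap (K := K), ← P.valuation_of_algebraMap (K := K)]
      rwa [show Valued.v (algebraMap (𝓞 K) (P.adicCompletion K) (z - z')) = _ from
          HeightOneSpectrum.valuedAdicCompletion_eq_valuation P _,
        show Valued.v (algebraMap (𝓞 K) (P.adicCompletion K) (1 - c)) = _ from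
          HeightOneSpectrum.valuedAdicCompletion_eq_valuation P _] at this
    · rw [intValuation_eq_one_of_not_dvd P hP]
      exact P.intValuation_le_one _
  · rintro ⟨y, hy⟩ P
    rw [hy, map_mul, map_mul]
    exact mul_le_of_le_one_right' (valued_algebraMap_le_one y)

/-- Each coordinate depends only on a residue modulo a power of its prime, so the Chinese remainder
theorem gives a common parameter. -/
lemma branchPoint_surjective (hc : c ≠ 1) (hw : ∀ P, w P = ballVertex 0 (N P)) :
    Function.Surjective (branchPoint hc hw) := by
  intro x
  have := finite_badPrimes hc
  have := Fintype.ofFinite (BadPrimes c)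
  have hx : ∀ P, (x P).1 ∈ SideBranch P.1 c (ballVertex 0 (N P)) := fun P =>
    (congrArg (fun y => (x P).1 ∈ SideBranch P.1 c y) (hw P)).mp (x P).2
  choose f hf using fun P : BadPrimes c => exists_branchVertex_eq (valued_one_sub hc P.1) (hx P)
  obtain ⟨z, hz⟩ := IsDedekindDomain.exists_forall_sub_mem_ideal (s := Finset.univ)
    (fun P : BadPrimes c => P.1.asIdeal) (fun P => depth hc P.1) (fun P _ => P.1.prime)
    (fun P _ Q _ hPQ h => hPQ (Subtype.ext (HeightOneSpectrum.ext h))) (fun P => f P.1)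
  refine ⟨z, funext fun P => Subtype.ext ?_⟩
  rw [← hf P]
  refine branchVertex_eq_iff.2 ?_
  rw [← map_sub]
  exact (valued_algebraMap_le_exp_iff _ _ _).2 (hz P (Finset.mem_univ P))

set_option synthInstance.maxHeartbeats 200000 in
lemma smul_branchPoint (hc : c ≠ 1) (hw : ∀ P, w P = ballVertex 0 (N P)) (u : (𝓞 K)ˣ) (z : 𝓞 K) :
    u • branchPoint hc hw z = branchPoint hc hw (u * z) := by
  funext P
  apply Subtype.ext
  have := smul_branchVertex u (N P) (depth hc P.1) (algebraMap (𝓞 K) (P.1.adicCompletion K) z)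
  rw [← map_mul] at this
  exact this

set_option synthInstance.maxHeartbeats 200000 in
/-- The orbits of the product of the side branches are parametrised by the algebraic integers
modulo `1 - c` up to units. -/
theorem exists_surjective_orbits (hc : c ≠ 1) (w : ∀ P : BadPrimes c, Vertex P.1)
    (hw : ∀ P, w P ∈ apartment P.1) :
    ∃ f : 𝓞 K → Orbits c w, Function.Surjective f ∧
      ∀ z z', f z = f z' ↔ ∃ u : (𝓞 K)ˣ, 1 - c ∣ u * z - z' := by
  choose N hN using fun P => exists_eq_ballVertex_zero (hw P)
  refine ⟨fun z => Quotient.mk _ (branchPoint hc hN z),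
    Quotient.mk_surjective.comp (branchPoint_surjective hc hN), fun z z' => ?_⟩
  rw [eq_comm, Quotient.eq, MulAction.orbitRel_apply, MulAction.mem_orbit_iff]
  refine exists_congr fun u => ?_
  rw [smul_branchPoint, branchPoint_eq_iff]

lemma finite_orbits (hc : c ≠ 1) (w : ∀ P : BadPrimes c, Vertex P.1)
    (hw : ∀ P, w P ∈ apartment P.1) : Finite (Orbits c w) := by
  obtain ⟨f, hf, hff⟩ := exists_surjective_orbits hc w hw
  have hbot : Ideal.span {1 - c} ≠ ⊥ := by
    rw [ne_eq, Ideal.span_singleton_eq_bot]; exact sub_ne_zero.2 hc.symm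
  have : Finite (𝓞 K ⧸ Ideal.span {1 - c}) := Ideal.finiteQuotientOfFreeOfNeBot _ hbot
  refine Finite.of_surjective (α := 𝓞 K ⧸ Ideal.span {1 - c}) (Quotient.lift f ?_) ?_
  · intro a b hab
    refine (hff a b).2 ⟨1, ?_⟩
    rw [← Ideal.mem_span_singleton, Units.val_one, one_mul]
    exact (Submodule.quotientRel_def _).1 hab
  · intro x
    obtain ⟨z, rfl⟩ := hf x
    exact ⟨Ideal.Quotient.mk _ z, rfl⟩

end BruhatTits

/-! ### Two-generated ideals in a Dedekind domain -/

namespace IntegralRep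

section Ideals

open nonZeroDivisors

variable {R : Type*} [CommRing R] [IsDedekindDomain R]

lemma exists_span_pair {J : Ideal R} (hJ : J ≠ ⊥) :
    ∃ p q : R, p ≠ 0 ∧ Ideal.span {p, q} = J := by
  obtain ⟨p, hp, hp0⟩ := J.ne_bot_iff.1 hJ
  obtain ⟨q, hq⟩ := IsDedekindDomain.exists_sup_span_eq (I := Ideal.span {p}) (J := J)
    (by rwa [Ideal.span_singleton_le_iff_mem]) (by simpa using hp0)
  exact ⟨p, q, hp0, by rw [Ideal.span_insert, hq]⟩

/-- Every ideal class is represented by an integral ideal coprime to a given nonzero element. -/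
lemma exists_mk0_eq_isCoprime (C : ClassGroup R) {d : R} (hd : d ≠ 0) :
    ∃ J : (Ideal R)⁰, ClassGroup.mk0 J = C ∧ IsCoprime (J : Ideal R) (Ideal.span {d}) := by
  obtain ⟨I, hI⟩ := ClassGroup.mk0_surjective C⁻¹
  have hI0 : (I : Ideal R) ≠ 0 := nonZeroDivisors.coe_ne_zero I
  have hd0 : Ideal.span {d} ≠ (0 : Ideal R) := by simpa using hd
  -- With `I` in the class `C⁻¹` and `I d + (a) = I`, the ideal `J = (a) I⁻¹` lies in `C` and
  -- satisfies `(d) + J = 1`. If `a = 0`, then `d` is a unit and any `J` works.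
  obtain ⟨a, ha⟩ := IsDedekindDomain.exists_sup_span_eq
    (I := (I : Ideal R) * Ideal.span {d}) (J := I) Ideal.mul_le_left (mul_ne_zero hI0 hd0)
  by_cases ha0 : a = 0
  · obtain ⟨J, hJ⟩ := ClassGroup.mk0_surjective C
    refine ⟨J, hJ, ?_⟩
    have : Ideal.span {d} = 1 := by
      apply mul_left_cancel₀ hI0
      simpa [ha0] using ha
    rw [this]
    exact isCoprime_one_right
  · have hdvd : (I : Ideal R) ∣ Ideal.span {a} := by
      rw [Ideal.dvd_iff_le]
      exact le_sup_right.trans_eq ha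
    obtain ⟨J, hJ⟩ := hdvd
    have hJ0 : J ≠ 0 := by
      rintro rfl
      rw [mul_zero] at hJ
      exact ha0 (by simpa using hJ)
    refine ⟨⟨J, mem_nonZeroDivisors_of_ne_zero hJ0⟩, ?_, ?_⟩
    · rw [← inv_inv C, ← hI, eq_inv_iff_mul_eq_one, ← map_mul, ClassGroup.mk0_eq_one_iff]
      refine ⟨⟨a, ?_⟩⟩
      rw [Submonoid.coe_mul, mul_comm, ← hJ]
    · rw [Ideal.isCoprime_iff_sup_eq, sup_comm, ← Ideal.one_eq_top]
      apply mul_left_cancel₀ hI0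
      rw [Ideal.mul_sup, ← hJ, ha, mul_one]

end Ideals

/-! ### Unimodular matrices with a prescribed first row -/

/-- A matrix `!![p, q; r, s]` of determinant one whose first row is integral and generates an
ideal `I`, and whose second row lies in `I⁻¹`; it maps `R²` onto `I ⊕ I⁻¹`. -/
structure UnimodularPair (R K : Type*) [CommRing R] [Field K] [Algebra R K] where
  (p q : R)
  (r s : K)
  (rp rq sp sq : R)
  algebraMap_rp : algebraMap R K rp = r * algebraMap R K p
  algebraMap_rq : algebraMap R K rq = r * algebraMap R K q
  algebraMap_sp : algebraMap R K sp = s * algebraMap R K p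
  algebraMap_sq : algebraMap R K sq = s * algebraMap R K q
  det_eq : algebraMap R K p * s - algebraMap R K q * r = 1

namespace UnimodularPair

section

variable {R K : Type*} [CommRing R] [Field K] [Algebra R K]

local notation "ι" => algebraMap R K

/-- Writing `(p) = (p, q) J` gives `p = p j + q k` with `j, k` in `J = p (p, q)⁻¹`; dividing by `p`,
the row `(-k / p, j / p)` completes `(p, q)` to determinant one. -/
lemma exists_of_span [IsDedekindDomain R] [FaithfulSMul R K] {p q : R} (hp : p ≠ 0) :
    ∃ D : UnimodularPair R K, D.p = p ∧ D.q = q := by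
  have hp' : ι p ≠ 0 := by simpa using hp
  have hdvd : Ideal.span {p, q} ∣ Ideal.span {p} := by
    rw [Ideal.dvd_iff_le]
    exact Ideal.span_mono (by simp)
  obtain ⟨J, hJ⟩ := hdvd
  have hmem : p ∈ Ideal.span {p, q} * J := hJ ▸ Ideal.mem_span_singleton_self p
  rw [Ideal.span_insert, Ideal.sup_mul] at hmem
  obtain ⟨_, hx, _, hy, hxy⟩ := Submodule.mem_sup.1 hmem
  obtain ⟨j, hj, rfl⟩ := Ideal.mem_span_singleton_mul.1 hx
  obtain ⟨k, hk, rfl⟩ := Ideal.mem_span_singleton_mul.1 hy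
  have hq : ∀ j ∈ J, p ∣ q * j := fun j hj => by
    rw [← Ideal.mem_span_singleton, hJ]
    exact Ideal.mul_mem_mul (Ideal.subset_span (by simp)) hj
  obtain ⟨qj, hqj⟩ := hq j hj
  obtain ⟨qk, hqk⟩ := hq k hk
  have hqj' := congrArg ι hqj
  have hqk' := congrArg ι hqk
  have hxy' := congrArg ι hxy
  rw [map_mul, map_mul] at hqj' hqk'
  rw [map_add, map_mul, map_mul] at hxy'
  refine ⟨⟨p, q, -(ι k / ι p), ι j / ι p, -k, -qk, j, qj, ?_, ?_, ?_, ?_, ?_⟩, rfl, rfl⟩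
  · rw [map_neg]; field_simp
  · rw [map_neg]; field_simp; linear_combination hqk'
  · field_simp
  · field_simp; linear_combination -hqj'
  · field_simp; linear_combination hxy'

/-- The matrix `!![1, 0; e, 1] * !![p, q; r, s]`. -/
def toGL (D : UnimodularPair R K) (e : K) : GL (Fin 2) K :=
  Matrix.GeneralLinearGroup.mkOfDetNeZero
    !![ι D.p, ι D.q; D.r + e * ι D.p, D.s + e * ι D.q] (by
      rw [Matrix.det_fin_two_of, show ι D.p * (D.s + e * ι D.q) - ι D.q * (D.r + e * ι D.p) = 1 by
        linear_combination D.det_eq]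
      exact one_ne_zero)

lemma coe_toGL (D : UnimodularPair R K) (e : K) : (D.toGL e : Matrix (Fin 2) (Fin 2) K) =
    !![ι D.p, ι D.q; D.r + e * ι D.p, D.s + e * ι D.q] := rfl

/-- For `M = !![p, q; r, s]` the matrix `U` must be `M⁻¹ * !![1, 0; -f, u] * M`, which is integral
once `f I² ⊆ R`; the elements `fpp`, `fpq`, `fqq` witness this inclusion. It serves to build
representations, to shift `e` by `I⁻²`, and to rescale it by a unit. -/
lemma exists_toGL_mul_eq [FaithfulSMul R K] (D : UnimodularPair R K) {e e' f : K} {fpp fpq fqq : R}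
    (u : Rˣ) (hpp : ι fpp = f * ι D.p * ι D.p) (hpq : ι fpq = f * ι D.p * ι D.q)
    (hqq : ι fqq = f * ι D.q * ι D.q) (h : e - f = ι u * e') :
    ∃ U : GL (Fin 2) R, D.toGL e * Matrix.GeneralLinearGroup.map ι U =
      diagOne (Units.map (ι : R →* K) u) * D.toGL e' := by
  have hι : Function.Injective ι := FaithfulSMul.algebraMap_injective R K
  have h1 := D.algebraMap_rp
  have h2 := D.algebraMap_rq
  have h3 := D.algebraMap_sp
  have h4 := D.algebraMap_sq
  have h5 := D.det_eq
  set M : Matrix (Fin 2) (Fin 2) R :=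
    !![D.sp + fpq - u * D.rq, D.sq + fqq - u * D.sq; -D.rp - fpp + u * D.rp,
      -D.rq - fpq + u * D.sp] with hM
  have hdet : M.det = u := by
    apply hι
    rw [hM, Matrix.det_fin_two_of]
    simp only [map_sub, map_mul, map_add, map_neg, h1, h2, h3, h4, hpp, hpq, hqq]
    linear_combination ι u * (ι D.p * D.s - ι D.q * D.r + 1) * h5
  refine ⟨Matrix.GeneralLinearGroup.mk'' M (hdet ▸ u.isUnit), ?_⟩
  apply Units.ext
  rw [Units.val_mul, Units.val_mul]
  change (D.toGL e : Matrix (Fin 2) (Fin 2) K) * M.map ι =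
    !![1, 0; 0, ι u] * (D.toGL e' : Matrix (Fin 2) (Fin 2) K)
  rw [coe_toGL, coe_toGL, hM, Matrix.mul_fin_two]
  obtain rfl : f = e - ι u * e' := by linear_combination -h
  ext i j
  fin_cases i <;> fin_cases j <;>
    simp [Matrix.mul_apply, Fin.sum_univ_two, h1, h2, h3, h4, hpp, hpq, hqq]
  · linear_combination ι D.p * h5
  · linear_combination ι D.q * h5
  · linear_combination (e * ι D.p + ι u * D.r - (e - ι u * e') * ι D.p) * h5
  · linear_combination (e * ι D.q + ι u * D.s - (e - ι u * e') * ι D.q) * h5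

/-- The scalar equations expressing that `U` conjugates the lattices of two matrices `toGL` up to
a diagonal matrix. -/
lemma eqs_of_toGL_mul_eq {D D' : UnimodularPair R K} {e e' α β : K} {U : GL (Fin 2) R}
    (h : (D'.toGL e' * Matrix.GeneralLinearGroup.map ι U : Matrix (Fin 2) (Fin 2) K) =
      !![α, 0; 0, β] * (D.toGL e : Matrix (Fin 2) (Fin 2) K)) :
    ι D'.p * ι (U 0 0) + ι D'.q * ι (U 1 0) = α * ι D.p ∧
    ι D'.p * ι (U 0 1) + ι D'.q * ι (U 1 1) = α * ι D.q ∧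
    (D'.r + e' * ι D'.p) * ι (U 0 0) + (D'.s + e' * ι D'.q) * ι (U 1 0) =
      β * (D.r + e * ι D.p) ∧
    (D'.r + e' * ι D'.p) * ι (U 0 1) + (D'.s + e' * ι D'.q) * ι (U 1 1) =
      β * (D.s + e * ι D.q) := by
  rw [coe_toGL, coe_toGL] at h
  have h00 := congrFun (congrFun h 0) 0
  have h01 := congrFun (congrFun h 0) 1
  have h10 := congrFun (congrFun h 1) 0
  have h11 := congrFun (congrFun h 1) 1
  simp [Matrix.mul_apply, Fin.sum_univ_two] at h00 h01 h10 h11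
  exact ⟨h00, h01, h10, h11⟩

variable {D : UnimodularPair R K} {e e' α β : K} {U : GL (Fin 2) R}

/-- A converse to `exists_toGL_mul_eq`: `U` is `M⁻¹ * !![α, 0; β e - α e', β] * M`, and its
integrality forces `(β e - α e') I² ⊆ R`. -/
lemma exists_mul_eq_of_toGL_mul_eq
    (h : (D.toGL e' * Matrix.GeneralLinearGroup.map ι U : Matrix (Fin 2) (Fin 2) K) =
      !![α, 0; 0, β] * (D.toGL e : Matrix (Fin 2) (Fin 2) K)) {b : R} (hb : ι b = β) :
    ∃ gpp gpq gqq : R, ι gpp = (β * e - α * e') * ι D.p * ι D.p ∧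
      ι gpq = (β * e - α * e') * ι D.p * ι D.q ∧ ι gqq = (β * e - α * e') * ι D.q * ι D.q := by
  obtain ⟨h1, h2, h3, h4⟩ := eqs_of_toGL_mul_eq h
  have k1 := D.algebraMap_rp
  have k2 := D.algebraMap_rq
  have k3 := D.algebraMap_sp
  have k4 := D.algebraMap_sq
  refine ⟨D.rp * U 0 0 + D.sp * U 1 0 - b * D.rp, D.rq * U 0 0 + D.sq * U 1 0 - b * D.rq,
    D.rq * U 0 1 + D.sq * U 1 1 - b * D.sq, ?_, ?_, ?_⟩ <;>
  simp only [map_add, map_sub, map_mul, k1, k2, k3, k4, hb]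
  · linear_combination ι D.p * h3 - e' * ι D.p * h1
  · linear_combination ι D.q * h3 - e' * ι D.q * h1
  · linear_combination ι D.q * h4 - e' * ι D.q * h2

/-- The diagonal entries `α`, `β` of `M * U * M⁻¹` are integral because `I I⁻¹ ⊆ R`, and their
product is the unit `det U`. -/
lemma exists_units_of_toGL_mul_eq [FaithfulSMul R K]
    (h : (D.toGL e' * Matrix.GeneralLinearGroup.map ι U : Matrix (Fin 2) (Fin 2) K) =
      !![α, 0; 0, β] * (D.toGL e : Matrix (Fin 2) (Fin 2) K)) :
    ∃ a b : Rˣ, ι a = α ∧ ι b = β := by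
  obtain ⟨h1, h2, h3, h4⟩ := eqs_of_toGL_mul_eq h
  have k1 := D.algebraMap_rp
  have k2 := D.algebraMap_rq
  have k3 := D.algebraMap_sp
  have k4 := D.algebraMap_sq
  have k5 := D.det_eq
  obtain ⟨a, ha⟩ : ∃ a : R, ι a = α := by
    refine ⟨D.sp * U 0 0 + D.sq * U 1 0 - (D.rp * U 0 1 + D.rq * U 1 1), ?_⟩
    simp only [map_add, map_sub, map_mul, k1, k2, k3, k4]
    linear_combination D.s * h1 - D.r * h2 + α * k5
  obtain ⟨b, hb⟩ : ∃ b : R, ι b = β := by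
    refine ⟨D.rp * U 0 1 + D.sp * U 1 1 - (D.rq * U 0 0 + D.sq * U 1 0), ?_⟩
    simp only [map_add, map_sub, map_mul, k1, k2, k3, k4]
    linear_combination ι D.p * h4 - ι D.q * h3 + β * k5 - e' * ι D.p * h2 + e' * ι D.q * h1
  have hab : a * b = U.val.det := by
    apply FaithfulSMul.algebraMap_injective R K
    have hdet := congrArg Matrix.det h
    rw [Matrix.det_mul, Matrix.det_mul, coe_toGL, coe_toGL, Matrix.det_fin_two_of,
      Matrix.det_fin_two_of, Matrix.det_fin_two_of] at hdet
    have hU : Matrix.det (Matrix.GeneralLinearGroup.map ι U : Matrix (Fin 2) (Fin 2) K) =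
        ι U.val.det := (RingHom.map_det ι U.val).symm
    rw [hU] at hdet
    rw [map_mul, ha, hb]
    linear_combination -hdet + (ι U.val.det - α * β) * k5
  have hunit : IsUnit (a * b) := hab ▸ (Matrix.isUnit_iff_isUnit_det _).1 U.isUnit
  obtain ⟨hau, hbu⟩ := IsUnit.mul_iff.1 hunit
  exact ⟨hau.unit, hbu.unit, ha, hb⟩

/-- A matrix of determinant one whose first row generates the same ideal as that of a unimodular
pair is of the form `toGL`, up to a right factor in `GL₂(R)`. -/
lemma exists_eq_toGL_mul [FaithfulSMul R K] (D : UnimodularPair R K) {p q : R}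
    (hpq : Ideal.span {p, q} = Ideal.span {D.p, D.q}) {S W : K} (hdet : ι p * W - ι q * S = 1) :
    ∃ (e : K) (V : GL (Fin 2) R), !![ι p, ι q; S, W] =
      (D.toGL e * Matrix.GeneralLinearGroup.map ι V : Matrix (Fin 2) (Fin 2) K) := by
  have hι : Function.Injective ι := FaithfulSMul.algebraMap_injective R K
  have k1 := D.algebraMap_rp
  have k2 := D.algebraMap_rq
  have k3 := D.algebraMap_sp
  have k4 := D.algebraMap_sq
  have k5 := D.det_eq
  obtain ⟨a, b, hp⟩ := Ideal.mem_span_pair.1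
    (hpq ▸ Ideal.subset_span (by simp) : p ∈ Ideal.span {D.p, D.q})
  obtain ⟨a', b', hq⟩ := Ideal.mem_span_pair.1
    (hpq ▸ Ideal.subset_span (by simp) : q ∈ Ideal.span {D.p, D.q})
  obtain ⟨c, d, hDp⟩ := Ideal.mem_span_pair.1
    (hpq ▸ Ideal.subset_span (by simp) : D.p ∈ Ideal.span {p, q})
  obtain ⟨c', d', hDq⟩ := Ideal.mem_span_pair.1
    (hpq ▸ Ideal.subset_span (by simp) : D.q ∈ Ideal.span {p, q})
  apply_fun ι at hp hq hDp hDq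
  simp only [map_add, map_mul] at hp hq hDp hDq
  -- Substituting the expressions of `D.p`, `D.q` in `p`, `q` into `D.det_eq` yields a row `(r',
  -- s')` in `I⁻¹` completing `(p, q)`. The given second row differs from it by a multiple `e` of
  -- `(p, q)`.
  set s' : K := ι c * D.s - ι c' * D.r with hs'
  set r' : K := -(ι d * D.s - ι d' * D.r) with hr'
  have hdet' : ι p * s' - ι q * r' = 1 := by
    rw [hs', hr']
    linear_combination k5 + D.s * hDp - D.r * hDq
  set e : K := s' * S - r' * W with he
  have hS : S = r' + e * ι p := by
    rw [he]; linear_combination r' * hdet - S * hdet'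
  have hW : W = s' + e * ι q := by
    rw [he]; linear_combination s' * hdet - W * hdet'
  set M : Matrix (Fin 2) (Fin 2) R :=
    !![a * D.sp + b * D.sq - (-(d * D.sq - d' * D.rq)),
      a' * D.sp + b' * D.sq - (c * D.sq - c' * D.rq);
      -(a * D.rp + b * D.rq) + -(d * D.sp - d' * D.rp),
      -(a' * D.rp + b' * D.rq) + (c * D.sp - c' * D.rp)] with hM
  have hMι : M.map ι = !![D.s * ι p - ι D.q * r', D.s * ι q - ι D.q * s';
      -D.r * ι p + ι D.p * r', -D.r * ι q + ι D.p * s'] := by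
    ext i j
    fin_cases i <;> fin_cases j <;>
      simp [hM, k1, k2, k3, k4, hs', hr', ← hp, ← hq] <;> ring
  have hdetM : M.det = 1 := by
    apply hι
    rw [RingHom.map_det, RingHom.mapMatrix_apply, hMι, Matrix.det_fin_two_of, map_one]
    linear_combination (ι D.p * D.s - ι D.q * D.r) * hdet' + k5
  refine ⟨e, Matrix.GeneralLinearGroup.mk'' M (hdetM ▸ isUnit_one), ?_⟩
  change _ = (D.toGL e : Matrix (Fin 2) (Fin 2) K) * M.map ι
  rw [coe_toGL, hMι, hS, hW, Matrix.mul_fin_two]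
  ext i j
  fin_cases i <;> fin_cases j <;> simp
  · linear_combination -ι p * k5
  · linear_combination -ι q * k5
  · linear_combination -(r' + e * ι p) * k5
  · linear_combination -(s' + e * ι q) * k5

end

end UnimodularPair

/-! ### Representations and conjugating matrices -/

section Representations

open Matrix

variable {K : Type*} [Field K] {G : Type*} [Group G]

local notation "ι" => algebraMap (𝓞 K) K
local notation "Γ" => Matrix.GeneralLinearGroup.map (n := Fin 2) (algebraMap (𝓞 K) K)

lemma map_injective : Function.Injective Γ :=
  Units.map_injective (f := ((RingHom.mapMatrix ι).toMonoidHom : Matrix (Fin 2) (Fin 2) (𝓞 K) →* _))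
    (Matrix.map_injective (FaithfulSMul.algebraMap_injective (𝓞 K) K))

variable {χ : G →* Kˣ} {g₀ : G}

/-- Since `χ g₀` generates the image of `χ`, one integral matrix conjugate to `diag(1, χ₀)`
suffices: its powers realise every value. -/
lemma exists_kConj (hg₀ : ∀ g : G, χ g ∈ Subgroup.zpowers (χ g₀)) {T : GL (Fin 2) K}
    {A : GL (Fin 2) (𝓞 K)} (h : T * Γ A = diagOne (χ g₀) * T) :
    ∃ φ : KConj χ, ∀ g, T * Γ (φ.1 g) * T⁻¹ = rho χ g := by
  choose k hk using fun g => Subgroup.mem_zpowers_iff.1 (hg₀ g)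
  have hA : Γ A = T⁻¹ * diagOne (χ g₀) * T := by rw [mul_assoc, ← h, inv_mul_cancel_left]
  have key : ∀ g, Γ (A ^ k g) = T⁻¹ * rho χ g * T := by
    intro g
    have : T⁻¹ * diagOne (χ g₀) * T = T⁻¹ * diagOne (χ g₀) * T⁻¹⁻¹ := by rw [inv_inv]
    rw [map_zpow, hA, this, conj_zpow, inv_inv, ← map_zpow, hk]
    rfl
  -- The exponents `k g` are arbitrary choices; multiplicativity is checked over `K`, where the
  -- matrices depend only on `χ g`.
  let φ : G →* GL (Fin 2) (𝓞 K) := MonoidHom.mk' (fun g => A ^ k g) fun g g' => by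
    apply map_injective
    rw [map_mul, key, key, key, map_mul]
    group
  have hφ : ∀ g, T * Γ (φ g) * T⁻¹ = rho χ g := by
    intro g
    change T * Γ (A ^ k g) * T⁻¹ = _
    rw [key]
    group
  exact ⟨⟨φ, T, hφ⟩, hφ⟩

/-- The matrix `T' U T⁻¹` intertwines `ρ_χ` with itself, hence commutes with `diag(1, χ₀)` and is
diagonal as `χ₀ ≠ 1`; conversely diagonal matrices commute with `ρ_χ`. -/
lemma equiv_iff_of_conj (hχ₀ : χ g₀ ≠ 1) {φ φ' : KConj χ} {T T' : GL (Fin 2) K}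
    (hT : ∀ g, T * Γ (φ.1 g) * T⁻¹ = rho χ g) (hT' : ∀ g, T' * Γ (φ'.1 g) * T'⁻¹ = rho χ g) :
    φ ≈ φ' ↔ ∃ (U : GL (Fin 2) (𝓞 K)) (α β : K),
      (T' * Γ U : Matrix (Fin 2) (Fin 2) K) = !![α, 0; 0, β] * (T : Matrix (Fin 2) (Fin 2) K) := by
  constructor
  · rintro ⟨U, hU⟩
    set X : GL (Fin 2) K := T' * Γ U * T⁻¹ with hX
    have hcomm : X * rho χ g₀ = rho χ g₀ * X := by
      have h1 : rho χ g₀ * X = T' * Γ (U * φ.1 g₀) * T⁻¹ := by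
        rw [← hT' g₀, ← hU g₀, hX]
        simp only [map_mul, map_inv]
        group
      rw [h1, ← hT g₀, hX, map_mul]
      group
    have hcomm' : X.val * !![1, 0; 0, (χ g₀ : K)] = !![1, 0; 0, (χ g₀ : K)] * X.val :=
      congrArg Units.val hcomm
    have hc : (χ g₀ : K) - 1 ≠ 0 := by
      rw [sub_ne_zero]; exact fun h => hχ₀ (Units.ext h)
    have h01 := congrFun (congrFun hcomm' 0) 1
    have h10 := congrFun (congrFun hcomm' 1) 0
    simp [Matrix.mul_apply, Fin.sum_univ_two] at h01 h10
    have e01 : X.val 0 1 = 0 := by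
      have : X.val 0 1 * ((χ g₀ : K) - 1) = 0 := by linear_combination h01
      exact (mul_eq_zero.1 this).resolve_right hc
    have e10 : X.val 1 0 = 0 := by
      have : X.val 1 0 * ((χ g₀ : K) - 1) = 0 := by linear_combination -h10
      exact (mul_eq_zero.1 this).resolve_right hc
    refine ⟨U, X.val 0 0, X.val 1 1, ?_⟩
    have hXval : !![X.val 0 0, 0; 0, X.val 1 1] = X.val := by
      ext i j
      fin_cases i <;> fin_cases j <;> simp [e01, e10]
    rw [hXval, ← Units.val_mul, ← Units.val_mul, hX, inv_mul_cancel_right]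
  · rintro ⟨U, α, β, h⟩
    set X : GL (Fin 2) K := T' * Γ U * T⁻¹ with hX
    have hXval : X.val = !![α, 0; 0, β] := by
      rw [hX, Units.val_mul, Units.val_mul, h, mul_assoc, ← Units.val_mul, mul_inv_cancel,
        Units.val_one, mul_one]
    refine ⟨U, fun g => map_injective ?_⟩
    have hcomm : X * rho χ g = rho χ g * X := by
      apply Units.ext
      change X.val * !![1, 0; 0, (χ g : K)] = !![1, 0; 0, (χ g : K)] * X.val
      rw [hXval, Matrix.mul_fin_two, Matrix.mul_fin_two]
      simp [mul_comm]
    have h1 : Γ (φ.1 g) = T⁻¹ * rho χ g * T := by rw [← hT g]; group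
    have h2 : Γ (φ'.1 g) = T'⁻¹ * rho χ g * T' := by rw [← hT' g]; group
    have h3 : Γ U = T'⁻¹ * X * T := by rw [hX]; group
    rw [map_mul, map_mul, map_inv, h1, h2, h3]
    calc T'⁻¹ * X * T * (T⁻¹ * rho χ g * T) * (T'⁻¹ * X * T)⁻¹
        = T'⁻¹ * (X * rho χ g) * X⁻¹ * T' := by group
      _ = T'⁻¹ * rho χ g * T' := by rw [hcomm]; group

end Representations

/-! ### The parametrisation of the conjugacy classes -/

section Parametrisation

lemma span_singleton_mul_span_pair {R : Type*} [CommRing R] (x p q : R) :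
    Ideal.span {x} * Ideal.span {p, q} = Ideal.span {x * p, x * q} := by
  rw [Ideal.span_mul_span']
  congr 1
  ext z
  simp [eq_comm]

open nonZeroDivisors

variable {R K : Type*} [CommRing R] [IsDedekindDomain R] [Field K] [Algebra R K]
  [IsFractionRing R K]

local notation "ι" => algebraMap R K

lemma exists_unimodularPair (C : ClassGroup R) {d : R} (hd : d ≠ 0) :
    ∃ D : UnimodularPair R K, (∃ J : (Ideal R)⁰, (J : Ideal R) = Ideal.span {D.p, D.q} ∧
      ClassGroup.mk0 J = C) ∧ ∃ x y t : R, x * D.p + y * D.q + t * d = 1 := by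
  obtain ⟨J, hJ, hcop⟩ := exists_mk0_eq_isCoprime C hd
  obtain ⟨p, q, hp, hpq⟩ := exists_span_pair (nonZeroDivisors.coe_ne_zero J)
  obtain ⟨D, rfl, rfl⟩ := UnimodularPair.exists_of_span (K := K) (q := q) hp
  refine ⟨D, ⟨J, hpq.symm, hJ⟩, ?_⟩
  obtain ⟨a, ha, b, hb, hab⟩ := Ideal.isCoprime_iff_exists.1 hcop
  rw [← hpq] at ha
  obtain ⟨x, y, rfl⟩ := Ideal.mem_span_pair.1 ha
  obtain ⟨t, rfl⟩ := Ideal.mem_span_singleton'.1 hb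
  exact ⟨x, y, t, hab⟩

/-- If two matrices `toGL` are related by `GL₂(R)` and a diagonal matrix, their first rows
generate ideals in the same class. -/
lemma exists_span_mul_eq_of_toGL_mul_eq {D D' : UnimodularPair R K} {e e' α β : K}
    {U : GL (Fin 2) R}
    (h : (D'.toGL e' * Matrix.GeneralLinearGroup.map ι U : Matrix (Fin 2) (Fin 2) K) =
      !![α, 0; 0, β] * (D.toGL e : Matrix (Fin 2) (Fin 2) K)) :
    ∃ a b : R, a ≠ 0 ∧ b ≠ 0 ∧
      Ideal.span {a} * Ideal.span {D.p, D.q} = Ideal.span {b} * Ideal.span {D'.p, D'.q} := by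
  have hα : α ≠ 0 := by
    rintro rfl
    have hdet : IsUnit (Matrix.det (D'.toGL e' * Matrix.GeneralLinearGroup.map ι U).val) :=
      (Matrix.isUnit_iff_isUnit_det _).1 (Units.isUnit _)
    rw [Units.val_mul, h, Matrix.det_mul, Matrix.det_fin_two_of] at hdet
    simp at hdet
  obtain ⟨h1, h2, -, -⟩ := UnimodularPair.eqs_of_toGL_mul_eq h
  obtain ⟨a, b, hb, rfl⟩ := IsFractionRing.div_surjective (A := R) α
  have hb0 : b ≠ 0 := nonZeroDivisors.ne_zero hb
  have hb' : ι b ≠ 0 := by simpa using hb0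
  have ha0 : a ≠ 0 := by rintro rfl; simp at hα
  have hι : Function.Injective ι := IsFractionRing.injective R K
  have hap : b * (D'.p * U 0 0 + D'.q * U 1 0) = a * D.p := by
    apply hι
    simp only [map_mul, map_add]
    rw [h1]; field_simp
  have haq : b * (D'.p * U 0 1 + D'.q * U 1 1) = a * D.q := by
    apply hι
    simp only [map_mul, map_add]
    rw [h2]; field_simp
  refine ⟨a, b, ha0, hb0, ?_⟩
  have hUV : U.val * U⁻¹.val = 1 := by rw [← Units.val_mul, mul_inv_cancel, Units.val_one]
  have u00 := congrFun (congrFun hUV 0) 0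
  have u01 := congrFun (congrFun hUV 0) 1
  have u10 := congrFun (congrFun hUV 1) 0
  have u11 := congrFun (congrFun hUV 1) 1
  rw [Matrix.mul_apply, Fin.sum_univ_two] at u00 u01 u10 u11
  rw [Matrix.one_apply_eq] at u00 u11
  rw [Matrix.one_apply_ne (by decide)] at u01 u10
  rw [span_singleton_mul_span_pair, span_singleton_mul_span_pair]
  apply le_antisymm <;> rw [Ideal.span_le, Set.insert_subset_iff, Set.singleton_subset_iff] <;>
    refine ⟨Ideal.mem_span_pair.2 ?_, Ideal.mem_span_pair.2 ?_⟩
  · exact ⟨U 0 0, U 1 0, by linear_combination hap⟩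
  · exact ⟨U 0 1, U 1 1, by linear_combination haq⟩
  · refine ⟨U⁻¹.val 0 0, U⁻¹.val 1 0, ?_⟩
    linear_combination -U⁻¹.val 0 0 * hap - U⁻¹.val 1 0 * haq + b * D'.p * u00 + b * D'.q * u10
  · refine ⟨U⁻¹.val 0 1, U⁻¹.val 1 1, ?_⟩
    linear_combination -U⁻¹.val 0 1 * hap - U⁻¹.val 1 1 * haq + b * D'.p * u01 + b * D'.q * u11

/-- Every invertible matrix is of the form `toGL` up to a left diagonal factor and a right factor
in `GL₂(R)`. -/
lemma exists_diag_mul_eq_toGL_mul (D : ClassGroup R → UnimodularPair R K)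
    (hD : ∀ C, ∃ J : (Ideal R)⁰, (J : Ideal R) = Ideal.span {(D C).p, (D C).q} ∧
      ClassGroup.mk0 J = C) (T : GL (Fin 2) K) :
    ∃ (C : ClassGroup R) (e α β : K) (V : GL (Fin 2) R), α ≠ 0 ∧ β ≠ 0 ∧
      !![α, 0; 0, β] * (T : Matrix (Fin 2) (Fin 2) K) =
        ((D C).toGL e * Matrix.GeneralLinearGroup.map ι V : Matrix (Fin 2) (Fin 2) K) := by
  have hι : Function.Injective ι := IsFractionRing.injective R K
  have hdet : T.val 0 0 * T.val 1 1 - T.val 0 1 * T.val 1 0 ≠ 0 := by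
    rw [← Matrix.det_fin_two]
    exact ((Matrix.isUnit_iff_isUnit_det _).1 T.isUnit).ne_zero
  obtain ⟨p₀, b, hb, hp₀⟩ := IsFractionRing.div_surjective (A := R) (T.val 0 0)
  obtain ⟨q₀, b', hb', hq₀⟩ := IsFractionRing.div_surjective (A := R) (T.val 0 1)
  have hb0 : ι b ≠ 0 := by simpa using nonZeroDivisors.ne_zero hb
  have hb0' : ι b' ≠ 0 := by simpa using nonZeroDivisors.ne_zero hb'
  have hne : Ideal.span {b' * p₀, b * q₀} ≠ 0 := by
    intro h0
    have h1 : b' * p₀ = 0 := by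
      simpa [h0] using (Ideal.subset_span (by simp) : b' * p₀ ∈ Ideal.span {b' * p₀, b * q₀})
    have h2 : b * q₀ = 0 := by
      simpa [h0] using (Ideal.subset_span (by simp) : b * q₀ ∈ Ideal.span {b' * p₀, b * q₀})
    have h1 := (mul_eq_zero.1 h1).resolve_left (nonZeroDivisors.ne_zero hb')
    have h2 := (mul_eq_zero.1 h2).resolve_left (nonZeroDivisors.ne_zero hb)
    rw [← hp₀, ← hq₀, h1, h2] at hdet
    simp at hdet
  set C := ClassGroup.mk0 ⟨Ideal.span {b' * p₀, b * q₀}, mem_nonZeroDivisors_of_ne_zero hne⟩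
    with hC
  obtain ⟨J, hJ, hJC⟩ := hD C
  obtain ⟨x, y, hx, hy, hxy⟩ := (ClassGroup.mk0_eq_mk0_iff).1 hJC.symm
  simp only [hJ] at hxy
  rw [span_singleton_mul_span_pair] at hxy
  have hmem : ∀ z, z ∈ Ideal.span {x * (b' * p₀), x * (b * q₀)} → ∃ z', y * z' = z := by
    intro z hz
    rw [hxy] at hz
    obtain ⟨z', -, hz'⟩ := Ideal.mem_span_singleton_mul.1 hz
    exact ⟨z', hz'⟩
  obtain ⟨p, hp⟩ := hmem (x * (b' * p₀)) (Ideal.subset_span (by simp))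
  obtain ⟨q, hq⟩ := hmem (x * (b * q₀)) (Ideal.subset_span (by simp))
  have hspan : Ideal.span {p, q} = Ideal.span {(D C).p, (D C).q} := by
    have hy0 : Ideal.span {y} ≠ 0 := by simpa using hy
    apply mul_left_cancel₀ hy0
    rw [← hxy, ← hp, ← hq, span_singleton_mul_span_pair]
  have hx' : ι x ≠ 0 := by simpa using hx
  have hy' : ι y ≠ 0 := by simpa using hy
  -- The factor `α` turns the first row of `T` into generators of the chosen ideal of its class; `β`
  -- below normalises the determinant to one.
  set α : K := ι x * ι b * ι b' / ι y with hα
  have hα0 : α ≠ 0 := by rw [hα]; positivity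
  have hαp : α * T.val 0 0 = ι p := by
    have := congrArg ι hp
    simp only [map_mul] at this
    rw [← hp₀, hα]; field_simp; linear_combination -this
  have hαq : α * T.val 0 1 = ι q := by
    have := congrArg ι hq
    simp only [map_mul] at this
    rw [← hq₀, hα]; field_simp; linear_combination -this
  set β : K := (α * (T.val 0 0 * T.val 1 1 - T.val 0 1 * T.val 1 0))⁻¹ with hβ
  have hβ1 : β * (α * (T.val 0 0 * T.val 1 1 - T.val 0 1 * T.val 1 0)) = 1 :=
    inv_mul_cancel₀ (mul_ne_zero hα0 hdet)
  have hβ0 : β ≠ 0 := left_ne_zero_of_mul_eq_one hβ1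
  obtain ⟨e, V, hV⟩ := (D C).exists_eq_toGL_mul hspan (S := β * T.val 1 0) (W := β * T.val 1 1)
    (by rw [← hαp, ← hαq]; linear_combination hβ1)
  refine ⟨C, e, α, β, V, hα0, hβ0, ?_⟩
  rw [← hV, ← hαp, ← hαq]
  ext i j
  fin_cases i <;> fin_cases j <;> simp [Matrix.mul_apply, Fin.sum_univ_two]

end Parametrisation

/-! ### Conjugacy classes as pairs of an ideal class and a residue modulo `1 - χ₀` up to units -/

section Classes

open nonZeroDivisors

variable {K : Type*} [Field K] {G : Type*} [Group G] [Finite G]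
  {χ : G →* Kˣ} {g₀ : G}

local notation "ι" => algebraMap (𝓞 K) K

lemma algebraMap_charValue (χ : G →* Kˣ) (g : G) : ι (charValue χ g) = χ g := rfl

/-- The value `χ(g)` as a unit of `𝓞_K`. -/
def charUnit (χ : G →* Kˣ) (g : G) : (𝓞 K)ˣ where
  val := charValue χ g
  inv := charValue χ g⁻¹
  val_inv := FaithfulSMul.algebraMap_injective (𝓞 K) K (by simp [algebraMap_charValue])
  inv_val := FaithfulSMul.algebraMap_injective (𝓞 K) K (by simp [algebraMap_charValue])

lemma map_charUnit (χ : G →* Kˣ) (g : G) : Units.map (ι : 𝓞 K →* K) (charUnit χ g) = χ g :=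
  Units.ext rfl

lemma charValue_ne_one (hχ₀ : χ g₀ ≠ 1) : charValue χ g₀ ≠ 1 := fun h =>
  hχ₀ (Units.ext (by rw [← algebraMap_charValue, h, map_one, Units.val_one]))

variable [NumberField K]

/-- The conjugacy classes are parametrised by an ideal class and an algebraic integer modulo
`1 - χ(g₀)` up to units. -/
theorem exists_surjective_classes (hg₀ : ∀ g : G, χ g ∈ Subgroup.zpowers (χ g₀))
    (hχ₀ : χ g₀ ≠ 1) :
    ∃ F : ClassGroup (𝓞 K) × 𝓞 K → Classes χ, Function.Surjective F ∧
      ∀ x y, F x = F y ↔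
        x.1 = y.1 ∧ ∃ u : (𝓞 K)ˣ, 1 - charValue χ g₀ ∣ u * x.2 - y.2 := by
  have hι : Function.Injective ι := FaithfulSMul.algebraMap_injective (𝓞 K) K
  set d : 𝓞 K := 1 - charValue χ g₀ with hd
  have hd0 : d ≠ 0 := sub_ne_zero.2 (charValue_ne_one hχ₀).symm
  have hd0' : ι d ≠ 0 := by simpa using hd0
  have hdc : ι d = 1 - χ g₀ := by rw [hd, map_sub, map_one, algebraMap_charValue]
  choose D hD x y t hxyt using
    fun C : ClassGroup (𝓞 K) => exists_unimodularPair (K := K) C hd0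
  have hrep : ∀ w : ClassGroup (𝓞 K) × 𝓞 K, ∃ φ : KConj χ, ∀ g,
      (D w.1).toGL (ι w.2 / ι d) * Matrix.GeneralLinearGroup.map ι (φ.1 g) *
        ((D w.1).toGL (ι w.2 / ι d))⁻¹ = rho χ g := by
    rintro ⟨C, z⟩
    -- With `e = z / d`, the shear entry is `e - χ₀ e = d e = z`, so integrality holds because `I`
    -- is an integral ideal.
    obtain ⟨A, hA⟩ := (D C).exists_toGL_mul_eq (e := ι z / ι d) (e' := ι z / ι d) (f := ι z)
      (fpp := z * (D C).p * (D C).p) (fpq := z * (D C).p * (D C).q)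
      (fqq := z * (D C).q * (D C).q) (charUnit χ g₀) (by simp) (by simp) (by simp) (by
        change _ = (χ g₀ : K) * _
        rw [show (χ g₀ : K) = 1 - ι d by rw [hdc]; ring]
        field_simp)
    rw [map_charUnit] at hA
    exact exists_kConj hg₀ hA
  choose φ hφ using hrep
  refine ⟨fun w => Quotient.mk _ (φ w), ?_, ?_⟩
  · intro q
    induction q using Quotient.inductionOn with
    | h ψ =>
    obtain ⟨T, hT⟩ := ψ.2
    obtain ⟨C, e, α, β, V, -, -, hV⟩ := exists_diag_mul_eq_toGL_mul D (fun C => hD C) T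
    have hA : ((D C).toGL e * Matrix.GeneralLinearGroup.map ι (V * ψ.1 g₀ * V⁻¹) :
        Matrix (Fin 2) (Fin 2) K) =
        !![1, 0; 0, (χ g₀ : K)] * ((D C).toGL e : Matrix (Fin 2) (Fin 2) K) := by
      have h1 : T * Matrix.GeneralLinearGroup.map ι (ψ.1 g₀) = rho χ g₀ * T := by
        rw [← hT g₀, inv_mul_cancel_right]
      have h2 : T.val * (Matrix.GeneralLinearGroup.map ι (ψ.1 g₀)).val =
          !![1, 0; 0, (χ g₀ : K)] * T.val := congrArg Units.val h1
      have h3 : ((D C).toGL e).val = !![α, 0; 0, β] * T.val *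
          (Matrix.GeneralLinearGroup.map ι V)⁻¹.val := by
        rw [hV, mul_assoc, ← Units.val_mul (Matrix.GeneralLinearGroup.map ι V), mul_inv_cancel,
          Units.val_one, mul_one]
      have h4 : (!![α, 0; 0, β] : Matrix (Fin 2) (Fin 2) K) * !![1, 0; 0, (χ g₀ : K)] =
          !![1, 0; 0, (χ g₀ : K)] * !![α, 0; 0, β] := by
        rw [Matrix.mul_fin_two, Matrix.mul_fin_two]
        simp [mul_comm]
      rw [map_mul, map_mul, map_inv, Units.val_mul, Units.val_mul, ← mul_assoc, ← mul_assoc, ← hV,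
        mul_assoc !![α, 0; 0, β], h2, ← mul_assoc !![α, 0; 0, β], h4, h3]
      simp only [mul_assoc]
    obtain ⟨gpp, gpq, gqq, hpp, hpq, hqq⟩ :=
      UnimodularPair.exists_mul_eq_of_toGL_mul_eq hA (b := charValue χ g₀) rfl
    -- The elements `gpp`, `gpq`, `gqq` are `-d e` times the products of generators of `I`, so `z =
    -- d e X²` with `X = x p + y q = 1 - t d`. As `1 - X² = t' d`, the difference `e - z / d = t' d
    -- e` lies in `I⁻²` and can be absorbed by `GL₂(𝓞_K)`.
    set z : 𝓞 K := -(x C * x C * gpp + 2 * x C * y C * gpq + y C * y C * gqq) with hz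
    set t' : 𝓞 K := t C * (2 * (x C * (D C).p + y C * (D C).q) + t C * d) with ht'
    have hχd : (χ g₀ : K) = 1 - ι d := by rw [hdc]; ring
    rw [hχd] at hpp hpq hqq
    have hone : ι (x C) * ι (D C).p + ι (y C) * ι (D C).q + ι (t C) * ι d = 1 := by
      simpa using congrArg ι (hxyt C)
    have ht'' : ι t' * ι d = 1 - (ι (x C) * ι (D C).p + ι (y C) * ι (D C).q) ^ 2 := by
      rw [ht']
      simp only [map_mul, map_add, map_ofNat]
      linear_combination
        (1 + (ι (x C) * ι (D C).p + ι (y C) * ι (D C).q + ι (t C) * ι d)) * hone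
    have hez : e - ι z / ι d = ι t' * ι d * e := by
      rw [ht'', hz]
      simp only [map_mul, map_add, map_neg, map_ofNat, hpp, hpq, hqq]
      field_simp
      ring
    obtain ⟨U, hU⟩ := (D C).exists_toGL_mul_eq (e := e) (e' := ι z / ι d) (f := ι t' * ι d * e)
      (fpp := -(t' * gpp)) (fpq := -(t' * gpq)) (fqq := -(t' * gqq)) 1
      (by rw [map_neg, map_mul, hpp]; ring) (by rw [map_neg, map_mul, hpq]; ring)
      (by rw [map_neg, map_mul, hqq]; ring) (by rw [← hez]; simp)
    rw [map_one, map_one, one_mul] at hU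
    refine ⟨(C, z), (Quotient.sound ?_).symm⟩
    refine (equiv_iff_of_conj hχ₀ hT (hφ (C, z))).2 ⟨U⁻¹ * V, α, β, ?_⟩
    rw [hV, ← hU, ← Units.val_mul, ← Units.val_mul, map_mul, map_inv]
    congr 1
    group
  · rintro ⟨C, z⟩ ⟨C', z'⟩
    refine Quotient.eq.trans ?_
    refine (equiv_iff_of_conj hχ₀ (hφ (C, z)) (hφ (C', z'))).trans ⟨?_, ?_⟩
    · rintro ⟨U, α, β, h⟩
      obtain rfl : C = C' := by
        obtain ⟨J, hJ, hJC⟩ := hD C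
        obtain ⟨J', hJ', hJC'⟩ := hD C'
        obtain ⟨a, b, ha, hb, hab⟩ := exists_span_mul_eq_of_toGL_mul_eq h
        rw [← hJC, ← hJC', ClassGroup.mk0_eq_mk0_iff]
        exact ⟨a, b, ha, hb, by rw [hJ, hJ', hab]⟩
      refine ⟨rfl, ?_⟩
      obtain ⟨a, b, ha, hb⟩ := UnimodularPair.exists_units_of_toGL_mul_eq h
      obtain ⟨gpp, gpq, gqq, hpp, hpq, hqq⟩ := UnimodularPair.exists_mul_eq_of_toGL_mul_eq h hb
      simp only at hpp hpq hqq
      have key : ∀ g m n : 𝓞 K, ι g = (β * (ι z / ι d) - α * (ι z' / ι d)) * ι m * ι n →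
          d * g = (b * z - a * z') * m * n := by
        intro g m n hg
        apply hι
        simp only [map_mul, map_sub, hg, ha, hb]
        field_simp
      have h1 := key _ _ _ hpp
      have h2 := key _ _ _ hpq
      have h3 := key _ _ _ hqq
      -- The element `d` divides `(b z - a z') X²`, and `X = x p + y q` is `1` modulo `d`.
      have hdvd : d ∣ b * z - a * z' := by
        refine ⟨x C * x C * gpp + 2 * x C * y C * gpq + y C * y C * gqq +
          t C * (1 + x C * (D C).p + y C * (D C).q) * (b * z - a * z'), ?_⟩
        linear_combination -(x C * x C) * h1 - 2 * x C * y C * h2 - y C * y C * h3 -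
          (b * z - a * z') * (1 + x C * (D C).p + y C * (D C).q) * hxyt C
      refine ⟨a⁻¹ * b, ?_⟩
      have : ((a⁻¹ * b : (𝓞 K)ˣ) : 𝓞 K) * z - z' = ((a⁻¹ : (𝓞 K)ˣ) : 𝓞 K) * (b * z - a * z') := by
        rw [mul_sub, Units.inv_mul_cancel_left, Units.val_mul, mul_assoc]
      simp only [this]
      exact hdvd.mul_left _
    · rintro ⟨h, u, k, hk⟩
      obtain rfl : C = C' := h
      simp only at hk
      have hk' := congrArg ι hk
      simp only [map_sub, map_mul] at hk'
      obtain ⟨U, hU⟩ := (D C).exists_toGL_mul_eq (e := ι z' / ι d) (e' := ι z / ι d) (f := -ι k)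
        (fpp := -k * (D C).p * (D C).p) (fpq := -k * (D C).p * (D C).q)
        (fqq := -k * (D C).q * (D C).q) u (by simp) (by simp) (by simp) (by
          field_simp; linear_combination -hk')
      exact ⟨U, 1, ι u, congrArg Units.val hU⟩

end Classes

end IntegralRep

/-- Two surjections with the same fibres have equivalent codomains. -/
lemma nonempty_equiv_of_surjective {X Y Z : Type*} {f : X → Y} {g : X → Z}
    (hf : Function.Surjective f) (hg : Function.Surjective g)
    (h : ∀ x x', f x = f x' ↔ g x = g x') : Nonempty (Y ≃ Z) := by
  refine ⟨Equiv.ofBijective (fun y => g (Function.surjInv hf y)) ⟨fun y y' hy => ?_, fun z => ?_⟩⟩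
  · have := (h _ _).2 hy
    rwa [Function.surjInv_eq hf, Function.surjInv_eq hf] at this
  · obtain ⟨x, rfl⟩ := hg z
    exact ⟨f x, (h _ _).1 (Function.surjInv_eq hf _)⟩

end

/-! ### Comparison of the two parametrisations -/

theorem theoremt5 {K : Type*} [Field K] [NumberField K] {G : Type*} [Group G] [Finite G]
    (χ : G →* Kˣ) (hχ : χ ≠ 1) (g₀ : G) (hg₀ : ∀ g : G, χ g ∈ Subgroup.zpowers (χ g₀))
    (w : ∀ P : BruhatTits.BadPrimes (IntegralRep.charValue χ g₀), BruhatTits.Vertex P.1)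
    (hw : ∀ P, w P ∈ BruhatTits.apartment P.1) :
    Finite (IntegralRep.Classes χ) ∧
    Finite (BruhatTits.Orbits (IntegralRep.charValue χ g₀) w) ∧
    Nat.card (IntegralRep.Classes χ) =
      Nat.card (BruhatTits.Orbits (IntegralRep.charValue χ g₀) w) *
        NumberField.classNumber K := by
 
  have hχ₀ : χ g₀ ≠ 1 := by
    intro h
    refine hχ (MonoidHom.ext fun g => ?_)
    simpa [h] using hg₀ g
  have hc := IntegralRep.charValue_ne_one hχ₀
  obtain ⟨F, hF, hFF⟩ := IntegralRep.exists_surjective_classes hg₀ hχ₀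
  obtain ⟨f, hf, hff⟩ := BruhatTits.exists_surjective_orbits hc w hw
  have hfin := BruhatTits.finite_orbits hc w hw
  -- Classes and pairs (ideal class, orbit) are quotients of the same set `ClassGroup (𝓞 K) × 𝓞 K`
  -- by the same relation.
  obtain ⟨E⟩ := nonempty_equiv_of_surjective hF
    (Function.Surjective.prodMap (Function.surjective_id (α := ClassGroup (𝓞 K))) hf)
    (fun x y => by
      rw [hFF, ← hff, Prod.ext_iff]
      rfl)
  refine ⟨Finite.of_equiv _ E.symm, hfin, ?_⟩
  rw [Nat.card_congr E, Nat.card_prod, mul_comm, NumberField.classNumber,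
    Nat.card_eq_fintype_card (α := ClassGroup (𝓞 K))]
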